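/- Let $k$ be a field. Algebras are unital associative $k$-algebras and $\otimes=\otimes_k$. Let $A$ be a Hopf algebra over $k$ and let $Z$ be a left $A$-Galois extension of $k$, that is, a non-zero left $A$-comodule algebra, with coaction $\alpha\colon Z\to A\otimes Z$ (an algebra morphism), such that the linear map $$\kappa_l=(1_A\otimes m_Z)\circ(\alpha\otimes 1_Z)\colon Z\otimes Z\to A\otimes Z$$ is bijective. Then there exist a Hopf algebra $B$ and an algebra $T$ such that $(A,B,Z,T)$ is a Hopf-Galois system whose left $A$-coaction on $Z$ is the given $\alpha$. Here a Hopf-Galois system consists of four non-zero algebras $(A,B,Z,T)$ such that: (HG1) $A$ and $B$ are bialgebras. (HG2) $Z$ is an $A$-$B$-bicomodule algebra: it is a left $A$-comodule algebra with coaction $\alpha\colon Z\to A\otimes Z$ and a right $B$-comodule algebra with coaction $\beta\colon Z\to Z\otimes B$, and $(\alpha\otimes 1_B)\circ\beta=(1_A\otimes\beta)\circ\alpha$. (HG3) There are algebra morphisms $\gamma\colon A\to Z\otimes T$ and $\delta\colon B\to T\otimes Z$ with $$(\gamma\otimes 1_Z)\circ\alpha=(1_Z\otimes\delta)\circ\beta,\qquad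 (1_A\otimes\gamma)\circ\Delta_A=(\alpha\otimes 1_T)\circ\gamma,\qquad (\delta\otimes 1_B)\circ\Delta_B=(1_T\otimes\beta)\circ\delta.$$ (HG4) There is a linear map $S\colon T\to Z$ with $$m_Z\circ(1_Z\otimes S)\circ\gamma=u_Z\circ\varepsilon_A,\qquad m_Z\circ(S\otimes 1_Z)\circ\delta=u_Z\circ\varepsilon_B.$$ In these formulas $m$, $u$, $\Delta$, $\varepsilon$ denote multiplication, unit, comultiplication and counit. -/

import Mathlib

open scoped TensorProduct

universe u v w

/-- A left `A`-comodule algebra structure on the `k`-algebra `Z`: a coassociative, counital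
coaction `α : Z → A ⊗ Z` which is a morphism of (unital) `k`-algebras. -/
structure LeftComoduleAlgebra (k A Z : Type*) [Field k] [Ring A] [Bialgebra k A]
    [Ring Z] [Algebra k Z] where
  /-- The coaction `α`. -/
  coact : Z →ₐ[k] A ⊗[k] Z
  /-- `(Δ ⊗ 1) ∘ α = (1 ⊗ α) ∘ α`. -/
  coassoc : (TensorProduct.assoc k A A Z).toLinearMap ∘ₗ
      (Coalgebra.comul (R := k) (A := A)).rTensor Z ∘ₗ coact.toLinearMap =
    coact.toLinearMap.lTensor A ∘ₗ coact.toLinearMap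
  /-- `(ε ⊗ 1) ∘ α = 1`. -/
  counit_coact : (TensorProduct.lid k Z).toLinearMap ∘ₗ
      (Coalgebra.counit (R := k) (A := A)).rTensor Z ∘ₗ coact.toLinearMap = LinearMap.id

/-- A right `B`-comodule algebra structure on the `k`-algebra `Z`: a coassociative, counital
coaction `β : Z → Z ⊗ B` which is a morphism of (unital) `k`-algebras. -/
structure RightComoduleAlgebra (k B Z : Type*) [Field k] [Ring B] [Bialgebra k B]
    [Ring Z] [Algebra k Z] where
  /-- The coaction `β`. -/
  coact : Z →ₐ[k] Z ⊗[k] B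
  /-- `(β ⊗ 1) ∘ β = (1 ⊗ Δ) ∘ β`. -/
  coassoc : (TensorProduct.assoc k Z B B).toLinearMap ∘ₗ
      coact.toLinearMap.rTensor B ∘ₗ coact.toLinearMap =
    (Coalgebra.comul (R := k) (A := B)).lTensor Z ∘ₗ coact.toLinearMap
  /-- `(1 ⊗ ε) ∘ β = 1`. -/
  counit_coact : (TensorProduct.rid k Z).toLinearMap ∘ₗ
      (Coalgebra.counit (R := k) (A := B)).lTensor Z ∘ₗ coact.toLinearMap = LinearMap.id

namespace LeftComoduleAlgebra

/-- The map `κ : Z ⊗ Z → A ⊗ Z`, `κ = (1 ⊗ m) ∘ (α ⊗ 1)`. -/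
noncomputable def galoisMap {k A Z : Type*} [Field k] [Ring A] [Bialgebra k A]
    [Ring Z] [Algebra k Z] (L : LeftComoduleAlgebra k A Z) : Z ⊗[k] Z →ₗ[k] A ⊗[k] Z :=
  (LinearMap.mul' k Z).lTensor A ∘ₗ (TensorProduct.assoc k A Z Z).toLinearMap ∘ₗ
    L.coact.toLinearMap.rTensor Z

/-- A left `A`-Galois extension of `k`: a non-zero left `A`-comodule algebra whose map `κ` is
bijective. -/
def IsGalois {k A Z : Type*} [Field k] [Ring A] [Bialgebra k A]
    [Ring Z] [Algebra k Z] (L : LeftComoduleAlgebra k A Z) : Prop :=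
  Nontrivial Z ∧ Function.Bijective L.galoisMap

end LeftComoduleAlgebra

/-- The structure of a Hopf-Galois system on `(A, B, Z, T)`, where `A` and `B` are bialgebras and
`Z` and `T` are algebras over the field `k`. -/
structure HopfGaloisSystem (k A B Z T : Type*) [Field k] [Ring A] [Bialgebra k A]
    [Ring B] [Bialgebra k B] [Ring Z] [Algebra k Z] [Ring T] [Algebra k T] where
  nontrivial_A : Nontrivial A
  nontrivial_B : Nontrivial B
  nontrivial_Z : Nontrivial Z
  nontrivial_T : Nontrivial T
  /-- The left coaction `α : Z → A ⊗ Z`. -/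
  left : LeftComoduleAlgebra k A Z
  /-- The right coaction `β : Z → Z ⊗ B`. -/
  right : RightComoduleAlgebra k B Z
  /-- `Z` is a bicomodule: `(α ⊗ 1) ∘ β = (1 ⊗ β) ∘ α`. -/
  bicomodule : (TensorProduct.assoc k A Z B).toLinearMap ∘ₗ
      left.coact.toLinearMap.rTensor B ∘ₗ right.coact.toLinearMap =
    right.coact.toLinearMap.lTensor A ∘ₗ left.coact.toLinearMap
  /-- The algebra morphism `γ : A → Z ⊗ T`. -/
  γ : A →ₐ[k] Z ⊗[k] T
  /-- The algebra morphism `δ : B → T ⊗ Z`. -/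
  δ : B →ₐ[k] T ⊗[k] Z
  /-- `(γ ⊗ 1) ∘ α = (1 ⊗ δ) ∘ β`. -/
  γ_left : (TensorProduct.assoc k Z T Z).toLinearMap ∘ₗ
      γ.toLinearMap.rTensor Z ∘ₗ left.coact.toLinearMap =
    δ.toLinearMap.lTensor Z ∘ₗ right.coact.toLinearMap
  /-- `(1 ⊗ γ) ∘ Δ = (α ⊗ 1) ∘ γ`. -/
  γ_comul : γ.toLinearMap.lTensor A ∘ₗ Coalgebra.comul (R := k) (A := A) =
    (TensorProduct.assoc k A Z T).toLinearMap ∘ₗ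
      left.coact.toLinearMap.rTensor T ∘ₗ γ.toLinearMap
  /-- `(δ ⊗ 1) ∘ Δ = (1 ⊗ β) ∘ δ`. -/
  δ_comul : (TensorProduct.assoc k T Z B).toLinearMap ∘ₗ
      δ.toLinearMap.rTensor B ∘ₗ Coalgebra.comul (R := k) (A := B) =
    right.coact.toLinearMap.lTensor T ∘ₗ δ.toLinearMap
  /-- The generalized antipode `S : T → Z`, a linear map. -/
  S : T →ₗ[k] Z
  /-- `m ∘ (1 ⊗ S) ∘ γ = u ∘ ε`. -/
  mul_S_γ : LinearMap.mul' k Z ∘ₗ S.lTensor Z ∘ₗ γ.toLinearMap =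
    Algebra.linearMap k Z ∘ₗ Coalgebra.counit (R := k) (A := A)
  /-- `m ∘ (S ⊗ 1) ∘ δ = u ∘ ε`. -/
  mul_S_δ : LinearMap.mul' k Z ∘ₗ S.rTensor Z ∘ₗ δ.toLinearMap =
    Algebra.linearMap k Z ∘ₗ Coalgebra.counit (R := k) (A := B)

/-! The model is a torsor Z under a group: the ternary operation (x, y, z) ↦ x y⁻¹ z recovers the
second group acting on it, from pairs of points. Dually, bijectivity of κ gives a translation map
τ(a) = κ⁻¹(a ⊗ 1), an algebra morphism A → Z ⊗ Zᵒᵖ, and μ = (τ ⊗ 1) ∘ α makes Z a quantum torsor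
(`quantumTorsor`), with legs written y⁽¹⁾ ⊗ y⁽²⁾ ⊗ y⁽³⁾.

B is the subalgebra of Zᵒᵖ ⊗ Z cut out by the descent condition x y⁽¹⁾ ⊗ y⁽²⁾ ⊗ y⁽³⁾ = 1 ⊗ x ⊗ y. It
is an equaliser, and tensoring over a field is exact, so μ and 1 ⊗ μ restrict to a coaction Z → Z ⊗
B and a comultiplication B → B ⊗ B (`lTensor_descent_μ`, `lTensor_descent_ext`,
`rTensor_descent_ext`). Multiplication is scalar-valued on B, which gives the counit
(`pairMul_tmul_one`). With T = Zᵒᵖ, γ = τ, δ the inclusion of B and S the identity map Zᵒᵖ → Z, the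
axioms of a Hopf-Galois system reduce to those of the torsor and of τ.

The harder point is the antipode of B, which is x ⊗ y ↦ x⁽¹⁾ y x⁽²⁾ ⊗ x⁽³⁾ (`flip`). Transported
along κ, the descent condition becomes a coinvariance condition for A, from which
`shift_eq_one_tmul_flip` shows that `flip` preserves B. The torsor axioms then give one antipode
identity. The other needs the form y ↦ θ(y), swapped with x, which `flip` takes on B
(`flip_eq_twist`), where θ(y) = S(y₍₋₁₎) ▷ y₍₀₎; only here does the antipode of A enter. -/

set_option maxSynthPendingDepth 3
set_option synthInstance.maxHeartbeats 200000

/-! ### Equalisers and injections under tensor products over a field. -/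

section TensorLift

variable {k : Type*} [Field k]

/-- Factor an algebra morphism through an injective one. -/
noncomputable def AlgHom.factorThrough {X Y C : Type*} [Ring X] [Algebra k X] [Ring Y]
    [Algebra k Y] [Ring C] [Algebra k C] (j : X →ₐ[k] Y) (hj : Function.Injective j)
    (f : C →ₐ[k] Y) (h : ∀ c, ∃ x, j x = f c) : C →ₐ[k] X :=
  (AlgEquiv.ofInjective j hj).symm.toAlgHom.comp (f.codRestrict j.range h)

theorem AlgHom.apply_factorThrough {X Y C : Type*} [Ring X] [Algebra k X] [Ring Y]
    [Algebra k Y] [Ring C] [Algebra k C] (j : X →ₐ[k] Y) (hj : Function.Injective j)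
    (f : C →ₐ[k] Y) (h : ∀ c, ∃ x, j x = f c) (c : C) :
    j (AlgHom.factorThrough j hj f h c) = f c :=
  congrArg Subtype.val
    ((AlgEquiv.ofInjective j hj).apply_symm_apply (f.codRestrict j.range h c))

/-- Flatness: M ⊗ - keeps exactness of ι followed by f - g, hence preserves the equaliser. -/
theorem exists_lTensor_eq (M : Type*) {X N P : Type*} [AddCommGroup M] [Module k M]
    [AddCommGroup X] [Module k X] [AddCommGroup N] [Module k N] [AddCommGroup P] [Module k P]
    (f g : N →ₗ[k] P) (ι : X →ₗ[k] N) (hι : ∀ t, (∃ x, ι x = t) ↔ f t = g t) (s : M ⊗[k] N)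
    (hs : f.lTensor M s = g.lTensor M s) : ∃ s', ι.lTensor M s' = s := by
  have hex : Function.Exact ι (f - g) := fun t => by
    rw [LinearMap.sub_apply, sub_eq_zero, ← hι, Set.mem_range]
  refine (Module.Flat.lTensor_exact M hex s).1 ?_
  rw [LinearMap.lTensor_sub, LinearMap.sub_apply, hs, sub_self]

theorem exists_rTensor_eq (M : Type*) {X N P : Type*} [AddCommGroup M] [Module k M]
    [AddCommGroup X] [Module k X] [AddCommGroup N] [Module k N] [AddCommGroup P] [Module k P]
    (f g : N →ₗ[k] P) (ι : X →ₗ[k] N) (hι : ∀ t, (∃ x, ι x = t) ↔ f t = g t) (s : N ⊗[k] M)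
    (hs : f.rTensor M s = g.rTensor M s) : ∃ s', ι.rTensor M s' = s := by
  have hex : Function.Exact ι (f - g) := fun t => by
    rw [LinearMap.sub_apply, sub_eq_zero, ← hι, Set.mem_range]
  refine (Module.Flat.rTensor_exact M hex s).1 ?_
  rw [LinearMap.rTensor_sub, LinearMap.sub_apply, hs, sub_self]

/-- Lift through the right factor first. The condition on the left factor then descends to N ⊗ X,
because 1 ⊗ ι is injective on P ⊗ X. -/
theorem exists_map_eq {X N P : Type*} [AddCommGroup X] [Module k X]
    [AddCommGroup N] [Module k N] [AddCommGroup P] [Module k P]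
    (f g : N →ₗ[k] P) (ι : X →ₗ[k] N) (hinj : Function.Injective ι)
    (hι : ∀ t, (∃ x, ι x = t) ↔ f t = g t) (s : N ⊗[k] N)
    (hl : f.lTensor N s = g.lTensor N s) (hr : f.rTensor N s = g.rTensor N s) :
    ∃ s', TensorProduct.map ι ι s' = s := by
  obtain ⟨s₁, rfl⟩ := exists_lTensor_eq N f g ι hι s hl
  have hinj : Function.Injective (ι.lTensor P) :=
    Module.Flat.lTensor_preserves_injective_linearMap _ hinj
  obtain ⟨s₂, rfl⟩ := exists_rTensor_eq X f g ι hι s₁ (hinj <| by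
    simpa only [← LinearMap.comp_apply, LinearMap.lTensor_comp_rTensor,
      LinearMap.rTensor_comp_lTensor] using hr)
  exact ⟨s₂, by rw [← LinearMap.comp_apply, LinearMap.lTensor_comp_rTensor]⟩

theorem tensorMap_injective {M N : Type*} [AddCommGroup M] [Module k M]
    [AddCommGroup N] [Module k N] (f : M →ₗ[k] N) (hf : Function.Injective f)
    {M' N' : Type*} [AddCommGroup M'] [Module k M'] [AddCommGroup N'] [Module k N']
    (g : M' →ₗ[k] N') (hg : Function.Injective g) :
    Function.Injective (TensorProduct.map f g) := by
  rw [← LinearMap.lTensor_comp_rTensor]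
  exact (Module.Flat.lTensor_preserves_injective_linearMap _ hg).comp
    (Module.Flat.rTensor_preserves_injective_linearMap _ hf)

/-- Since ι ⊗ ι ⊗ ι is injective, coassociativity can be tested in the ambient space, where D
becomes E. -/
theorem coassoc_of_injective {X N : Type*} [AddCommGroup X] [Module k X] [AddCommGroup N]
    [Module k N] (ι : X →ₗ[k] N) (hι : Function.Injective ι) (D : X →ₗ[k] X ⊗[k] X)
    (E : N →ₗ[k] N ⊗[k] N) (hD : ∀ x, TensorProduct.map ι ι (D x) = E (ι x)) (x : X)
    (hE : TensorProduct.assoc k N N N (E.rTensor N (E (ι x))) = E.lTensor N (E (ι x))) :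
    TensorProduct.assoc k X X X (D.rTensor X (D x)) = D.lTensor X (D x) := by
  apply tensorMap_injective ι hι _ (tensorMap_injective ι hι ι hι)
  have h₁ : ∀ s, TensorProduct.map ι (TensorProduct.map ι ι)
      (TensorProduct.assoc k X X X (D.rTensor X s)) =
      TensorProduct.assoc k N N N (E.rTensor N (TensorProduct.map ι ι s)) := fun s => by
    induction s using TensorProduct.induction_on with
    | zero => simp
    | add a b ha hb => simp only [map_add, ha, hb]
    | tmul a b =>
      rw [TensorProduct.map_tmul, LinearMap.rTensor_tmul, LinearMap.rTensor_tmul, ← hD]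
      induction D a using TensorProduct.induction_on with
      | zero => simp
      | add a b ha hb => simp only [map_add, TensorProduct.add_tmul, ha, hb]
      | tmul a b => simp
  have h₂ : ∀ s, TensorProduct.map ι (TensorProduct.map ι ι) (D.lTensor X s) =
      E.lTensor N (TensorProduct.map ι ι s) := fun s => by
    induction s using TensorProduct.induction_on with
    | zero => simp
    | add a b ha hb => simp only [map_add, ha, hb]
    | tmul a b => simp [hD]
  rw [h₁, h₂, hD, hE]

theorem coact_coassoc_of_injective {X N Z : Type*} [AddCommGroup X] [Module k X] [AddCommGroup N]
    [Module k N] [AddCommGroup Z] [Module k Z] (ι : X →ₗ[k] N) (hι : Function.Injective ι)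
    (D : X →ₗ[k] X ⊗[k] X) (E : N →ₗ[k] N ⊗[k] N)
    (hD : ∀ x, TensorProduct.map ι ι (D x) = E (ι x)) (b : Z →ₗ[k] Z ⊗[k] X)
    (m : Z →ₗ[k] Z ⊗[k] N) (hb : ∀ z, ι.lTensor Z (b z) = m z) (z : Z)
    (hm : TensorProduct.assoc k Z N N (m.rTensor N (m z)) = E.lTensor Z (m z)) :
    TensorProduct.assoc k Z X X (b.rTensor X (b z)) = D.lTensor Z (b z) := by
  apply Module.Flat.lTensor_preserves_injective_linearMap _ (tensorMap_injective ι hι ι hι)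
  have h₁ : ∀ s, (TensorProduct.map ι ι).lTensor Z
      (TensorProduct.assoc k Z X X (b.rTensor X s)) =
      TensorProduct.assoc k Z N N (m.rTensor N (ι.lTensor Z s)) := fun s => by
    induction s using TensorProduct.induction_on with
    | zero => simp
    | add a b ha hb => simp only [map_add, ha, hb]
    | tmul z a =>
      rw [LinearMap.lTensor_tmul, LinearMap.rTensor_tmul, LinearMap.rTensor_tmul, ← hb]
      induction b z using TensorProduct.induction_on with
      | zero => simp
      | add a b ha hb => simp only [map_add, TensorProduct.add_tmul, ha, hb]
      | tmul a b => simp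
  have h₂ : ∀ s, (TensorProduct.map ι ι).lTensor Z (D.lTensor Z s) =
      E.lTensor Z (ι.lTensor Z s) := fun s => by
    induction s using TensorProduct.induction_on with
    | zero => simp
    | add a b ha hb => simp only [map_add, ha, hb]
    | tmul a b => simp [hD]
  rw [h₁, h₂, hb, hm]

end TensorLift

/-! ### Extending a ternary cooperation to V ⊗ Z. -/

section Extension

variable {k V Z : Type*} [Field k] [AddCommGroup V] [Module k V] [AddCommGroup Z] [Module k Z]

/-- The extension `x ⊗ y ↦ x ⊗ m y` of a linear map `m : Z → Z ⊗ V ⊗ Z`. -/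
noncomputable def extendLeft (m : Z →ₗ[k] Z ⊗[k] (V ⊗[k] Z)) :
    V ⊗[k] Z →ₗ[k] (V ⊗[k] Z) ⊗[k] (V ⊗[k] Z) :=
  (TensorProduct.assoc k V Z (V ⊗[k] Z)).symm.toLinearMap ∘ₗ m.lTensor V

theorem extendLeft_tmul (m : Z →ₗ[k] Z ⊗[k] (V ⊗[k] Z)) (x : V) (y : Z) :
    extendLeft m (x ⊗ₜ y) = (TensorProduct.assoc k V Z (V ⊗[k] Z)).symm (x ⊗ₜ m y) := rfl

theorem extendLeft_assoc (m : Z →ₗ[k] Z ⊗[k] (V ⊗[k] Z))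
    (hm : ∀ z, TensorProduct.assoc k Z (V ⊗[k] Z) (V ⊗[k] Z) (m.rTensor (V ⊗[k] Z) (m z)) =
      (extendLeft m).lTensor Z (m z)) (t : V ⊗[k] Z) :
    TensorProduct.assoc k (V ⊗[k] Z) (V ⊗[k] Z) (V ⊗[k] Z)
      ((extendLeft m).rTensor (V ⊗[k] Z) (extendLeft m t)) =
    (extendLeft m).lTensor (V ⊗[k] Z) (extendLeft m t) := by
  induction t using TensorProduct.induction_on with
  | zero => simp
  | add a b ha hb => simp only [map_add, ha, hb]
  | tmul x y =>
    have h := congrArg (fun s => (TensorProduct.assoc k V Z _).symm (x ⊗ₜ[k] s)) (hm y)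
    rw [extendLeft_tmul]
    convert h using 1
    · induction m y using TensorProduct.induction_on with
      | zero => simp
      | add a b ha hb => simp only [TensorProduct.tmul_add, map_add, ha, hb]
      | tmul p s =>
        simp only [TensorProduct.assoc_symm_tmul, LinearMap.rTensor_tmul, extendLeft_tmul]
        induction m p using TensorProduct.induction_on with
        | zero => simp
        | add a b ha hb =>
          simp only [TensorProduct.tmul_add, TensorProduct.add_tmul, map_add, ha, hb]
        | tmul p' s' => simp
    · induction m y using TensorProduct.induction_on with
      | zero => simp
      | add a b ha hb => simp only [TensorProduct.tmul_add, map_add, ha, hb]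
      | tmul p s => simp

theorem lTensor_extendLeft (m : Z →ₗ[k] Z ⊗[k] (V ⊗[k] Z)) {P : Type*} [AddCommGroup P]
    [Module k P] (f : V ⊗[k] Z →ₗ[k] P) (t : V ⊗[k] Z) :
    f.lTensor (V ⊗[k] Z) (extendLeft m t) =
      (TensorProduct.assoc k V Z P).symm ((f.lTensor Z ∘ₗ m).lTensor V t) := by
  induction t using TensorProduct.induction_on with
  | zero => simp
  | add a b ha hb => simp only [map_add, ha, hb]
  | tmul x y =>
    rw [extendLeft_tmul, LinearMap.lTensor_tmul, LinearMap.comp_apply]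
    induction m y using TensorProduct.induction_on with
    | zero => simp
    | add a b ha hb => simp only [TensorProduct.tmul_add, map_add, ha, hb]
    | tmul p s => simp

theorem lTensor_extendLeft_eq_tmul (m : Z →ₗ[k] Z ⊗[k] (V ⊗[k] Z)) (q : V ⊗[k] Z →ₗ[k] Z) (e : Z)
    (hq : ∀ z, q.lTensor Z (m z) = z ⊗ₜ e) (t : V ⊗[k] Z) :
    q.lTensor (V ⊗[k] Z) (extendLeft m t) = t ⊗ₜ e := by
  have h : q.lTensor Z ∘ₗ m = (TensorProduct.mk k Z Z).flip e := LinearMap.ext hq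
  rw [lTensor_extendLeft, h]
  induction t using TensorProduct.induction_on with
  | zero => simp
  | add a b ha hb => simp only [map_add, ha, hb, TensorProduct.add_tmul]
  | tmul x y => simp

/-- For a torsor, this puts the last two legs of μ z in the structure algebra. By `hm`, extending
the last two legs amounts to applying m to the first one, and q then collapses by `hq`. -/
theorem lTensor_rTensor_extendLeft (m : Z →ₗ[k] Z ⊗[k] (V ⊗[k] Z))
    (hm : ∀ z, TensorProduct.assoc k Z (V ⊗[k] Z) (V ⊗[k] Z) (m.rTensor (V ⊗[k] Z) (m z)) =
      (extendLeft m).lTensor Z (m z)) (q : V ⊗[k] Z →ₗ[k] Z) (e : Z)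
    (hq : ∀ z, q.lTensor Z (m z) = z ⊗ₜ e) (z : Z) :
    (q.rTensor (V ⊗[k] Z) ∘ₗ extendLeft m).lTensor Z (m z) =
      (TensorProduct.mk k Z (V ⊗[k] Z) e).lTensor Z (m z) := by
  rw [LinearMap.lTensor_comp, LinearMap.comp_apply, ← hm]
  generalize m z = s
  induction s using TensorProduct.induction_on with
  | zero => simp
  | add a b ha hb => simp only [map_add, ha, hb]
  | tmul p s =>
    have h := congrArg (fun r => TensorProduct.assoc k Z Z (V ⊗[k] Z) (r ⊗ₜ[k] s)) (hq p)
    rw [LinearMap.rTensor_tmul, LinearMap.lTensor_tmul, TensorProduct.mk_apply]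
    rw [TensorProduct.assoc_tmul] at h
    rw [← h]
    induction m p using TensorProduct.induction_on with
    | zero => simp
    | add a b ha hb => simp only [map_add, ha, hb, TensorProduct.add_tmul]
    | tmul p' s' => simp

/-- The left factor of the comultiplication inherits the descent condition from t: coassociativity
moves the second extension to the right factor, away from q, so that `ht` applies. -/
theorem rTensor_rTensor_extendLeft (m : Z →ₗ[k] Z ⊗[k] (V ⊗[k] Z))
    (hm : ∀ z, TensorProduct.assoc k Z (V ⊗[k] Z) (V ⊗[k] Z) (m.rTensor (V ⊗[k] Z) (m z)) =
      (extendLeft m).lTensor Z (m z)) (q : V ⊗[k] Z →ₗ[k] Z) (e : Z) (t : V ⊗[k] Z)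
    (ht : q.rTensor (V ⊗[k] Z) (extendLeft m t) = e ⊗ₜ t) :
    (q.rTensor (V ⊗[k] Z) ∘ₗ extendLeft m).rTensor (V ⊗[k] Z) (extendLeft m t) =
      (TensorProduct.mk k Z (V ⊗[k] Z) e).rTensor (V ⊗[k] Z) (extendLeft m t) := by
  apply (TensorProduct.assoc k Z (V ⊗[k] Z) (V ⊗[k] Z)).injective
  have h₁ : ∀ s, TensorProduct.assoc k Z (V ⊗[k] Z) (V ⊗[k] Z)
      ((q.rTensor (V ⊗[k] Z)).rTensor (V ⊗[k] Z) s) =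
      q.rTensor _ (TensorProduct.assoc k (V ⊗[k] Z) (V ⊗[k] Z) (V ⊗[k] Z) s) := fun s => by
    rw [← LinearEquiv.coe_coe, ← LinearEquiv.coe_coe, ← LinearMap.comp_apply,
      ← LinearMap.comp_apply]
    congr 1
    exact TensorProduct.ext_threefold fun _ _ _ => rfl
  have h₂ : ∀ s, TensorProduct.assoc k Z (V ⊗[k] Z) (V ⊗[k] Z)
      ((TensorProduct.mk k Z (V ⊗[k] Z) e).rTensor (V ⊗[k] Z) s) = e ⊗ₜ s := fun s => by
    induction s using TensorProduct.induction_on with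
    | zero => simp
    | add a b ha hb => simp only [map_add, ha, hb, TensorProduct.tmul_add]
    | tmul a b => simp
  rw [LinearMap.rTensor_comp, LinearMap.comp_apply, h₁, extendLeft_assoc m hm, h₂,
    ← LinearMap.comp_apply, LinearMap.rTensor_comp_lTensor, ← LinearMap.lTensor_comp_rTensor,
    LinearMap.comp_apply, ht, LinearMap.lTensor_tmul]

end Extension

/-! ### The algebra Zᵒᵖ ⊗ Z and quantum torsors. -/

section Pairs

variable (k : Type*) [Field k] (Z : Type*) [Ring Z] [Algebra k Z]

/-- The algebra `Zᵒᵖ ⊗ Z`. -/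
abbrev Pairs := Zᵐᵒᵖ ⊗[k] Z

/-- Multiplication `x ⊗ y ↦ x y`, as a map `Zᵒᵖ ⊗ Z → Z`. -/
noncomputable def pairMul : Pairs k Z →ₗ[k] Z :=
  LinearMap.mul' k Z ∘ₗ (MulOpposite.opLinearEquiv k).symm.toLinearMap.rTensor Z

/-- The map `p ⊗ (q ⊗ r) ↦ p q ⊗ r`. -/
noncomputable def collapse : Z ⊗[k] Pairs k Z →ₗ[k] Pairs k Z :=
  TensorProduct.lift ((LinearMap.mul k (Pairs k Z)).flip ∘ₗ
    Algebra.TensorProduct.includeLeft.toLinearMap ∘ₗ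
    (MulOpposite.opLinearEquiv k).toLinearMap)

variable {k Z}

@[simp] theorem pairMul_tmul (x : Zᵐᵒᵖ) (y : Z) :
    pairMul k Z (x ⊗ₜ y) = x.unop * y := rfl

@[simp] theorem collapse_tmul (p : Z) (s : Pairs k Z) :
    collapse k Z (p ⊗ₜ s) = s * (MulOpposite.op p ⊗ₜ 1) := rfl

/-- The algebra morphism `x ⊗ y ↦ x ⊗ μ y` extending `μ : Z → Z ⊗ Zᵒᵖ ⊗ Z`. -/
noncomputable def pairComul (μ : Z →ₐ[k] Z ⊗[k] Pairs k Z) :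
    Pairs k Z →ₐ[k] Pairs k Z ⊗[k] Pairs k Z :=
  (Algebra.TensorProduct.assoc k k k Zᵐᵒᵖ Z (Pairs k Z)).symm.toAlgHom.comp
    (Algebra.TensorProduct.map (AlgHom.id k Zᵐᵒᵖ) μ)

end Pairs

/-- A quantum torsor structure on the algebra `Z`: an algebra morphism
`μ : Z → Z ⊗ Zᵒᵖ ⊗ Z` satisfying the analogues of the axioms of a ternary operation
`(x, y, z) ↦ x y⁻¹ z`. -/
structure QuantumTorsor (k Z : Type*) [Field k] [Ring Z] [Algebra k Z] where
  μ : Z →ₐ[k] Z ⊗[k] Pairs k Z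
  collapse_μ : ∀ z, collapse k Z (μ z) = 1 ⊗ₜ z
  lTensor_pairMul_μ : ∀ z, (pairMul k Z).lTensor Z (μ z) = z ⊗ₜ 1
  μ_assoc : ∀ z, TensorProduct.assoc k Z (Pairs k Z) (Pairs k Z)
    (μ.toLinearMap.rTensor (Pairs k Z) (μ z)) = (extendLeft μ.toLinearMap).lTensor Z (μ z)

/-! ### The descent condition and the structure algebra. -/

namespace QuantumTorsor

variable {k Z : Type*} [Field k] [Ring Z] [Algebra k Z] (Q : QuantumTorsor k Z)

/-- The map `x ⊗ y ↦ x ⊗ y⁽¹⁾ ⊗ y⁽²⁾ ⊗ y⁽³⁾`. -/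
noncomputable def ext : Pairs k Z →ₗ[k] Pairs k Z ⊗[k] Pairs k Z :=
  extendLeft Q.μ.toLinearMap

theorem ext_tmul (x : Zᵐᵒᵖ) (y : Z) :
    Q.ext (x ⊗ₜ y) = (TensorProduct.assoc k Zᵐᵒᵖ Z (Pairs k Z)).symm (x ⊗ₜ Q.μ y) := rfl

/-- The map `x ⊗ y ↦ x y⁽¹⁾ ⊗ y⁽²⁾ ⊗ y⁽³⁾`. -/
noncomputable def descent : Pairs k Z →ₗ[k] Z ⊗[k] Pairs k Z :=
  (pairMul k Z).rTensor (Pairs k Z) ∘ₗ Q.ext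

theorem ext_assoc (t : Pairs k Z) :
    TensorProduct.assoc k (Pairs k Z) (Pairs k Z) (Pairs k Z)
      (Q.ext.rTensor (Pairs k Z) (Q.ext t)) = Q.ext.lTensor (Pairs k Z) (Q.ext t) :=
  extendLeft_assoc _ Q.μ_assoc t

theorem lTensor_pairMul_ext (t : Pairs k Z) :
    (pairMul k Z).lTensor (Pairs k Z) (Q.ext t) = t ⊗ₜ 1 :=
  lTensor_extendLeft_eq_tmul _ _ _ Q.lTensor_pairMul_μ t

theorem lTensor_descent_μ (z : Z) :
    Q.descent.lTensor Z (Q.μ z) = (TensorProduct.mk k Z (Pairs k Z) 1).lTensor Z (Q.μ z) :=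
  lTensor_rTensor_extendLeft _ Q.μ_assoc _ _ Q.lTensor_pairMul_μ z

theorem lTensor_descent_ext (t : Pairs k Z) :
    Q.descent.lTensor (Pairs k Z) (Q.ext t) =
      (TensorProduct.mk k Z (Pairs k Z) 1).lTensor (Pairs k Z) (Q.ext t) := by
  rw [ext, lTensor_extendLeft, lTensor_extendLeft]
  congr 3
  exact LinearMap.ext Q.lTensor_descent_μ

theorem rTensor_descent_ext (t : Pairs k Z) (ht : Q.descent t = 1 ⊗ₜ t) :
    Q.descent.rTensor (Pairs k Z) (Q.ext t) =
      (TensorProduct.mk k Z (Pairs k Z) 1).rTensor (Pairs k Z) (Q.ext t) :=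
  rTensor_rTensor_extendLeft _ Q.μ_assoc _ _ t ht

theorem descent_tmul (x : Zᵐᵒᵖ) (y : Z) :
    Q.descent (x ⊗ₜ y) = (x.unop ⊗ₜ 1) * Q.μ y := by
  simp only [descent, LinearMap.comp_apply, ext_tmul]
  induction Q.μ y using TensorProduct.induction_on with
  | zero => simp only [TensorProduct.tmul_zero, map_zero, mul_zero]
  | add a b ha hb => simp only [TensorProduct.tmul_add, map_add, ha, hb, mul_add]
  | tmul p s =>
    rw [TensorProduct.assoc_symm_tmul, LinearMap.rTensor_tmul, pairMul_tmul,
      Algebra.TensorProduct.tmul_mul_tmul, one_mul]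

theorem descent_mul_op (s : Pairs k Z) (p : Z) :
    Q.descent (s * (MulOpposite.op p ⊗ₜ 1)) = (p ⊗ₜ 1) * Q.descent s := by
  induction s using TensorProduct.induction_on with
  | zero => simp only [zero_mul, map_zero, mul_zero]
  | add a b ha hb => simp only [add_mul, mul_add, map_add, ha, hb]
  | tmul x y =>
    rw [Algebra.TensorProduct.tmul_mul_tmul, descent_tmul, descent_tmul, ← mul_assoc,
      Algebra.TensorProduct.tmul_mul_tmul, mul_one, mul_one, MulOpposite.unop_mul,
      MulOpposite.unop_op]

theorem descent_mul_one_tmul (s : Pairs k Z) (y : Z) :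
    Q.descent (s * (1 ⊗ₜ y)) = Q.descent s * Q.μ y := by
  induction s using TensorProduct.induction_on with
  | zero => simp only [zero_mul, map_zero]
  | add s t hs ht => simp only [add_mul, map_add, hs, ht]
  | tmul p q =>
    rw [Algebra.TensorProduct.tmul_mul_tmul, descent_tmul, descent_tmul, map_mul, mul_one,
      mul_assoc]

/-- The Zᵒᵖ leg of t comes out as a left factor in Z and the Z leg as a right factor μ y; by `ha`
the middle factor is 1 ⊗ a, which commutes with x ⊗ 1. This closes the structure algebra under
products. -/
theorem descent_mul (a t : Pairs k Z) (ha : Q.descent a = 1 ⊗ₜ a) :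
    Q.descent (a * t) = (1 ⊗ₜ a) * Q.descent t := by
  induction t using TensorProduct.induction_on with
  | zero => simp only [map_zero, mul_zero]
  | add s t hs ht => simp only [mul_add, map_add, hs, ht]
  | tmul x y =>
    have hxy : (x ⊗ₜ[k] y : Pairs k Z) = (1 ⊗ₜ y) * (MulOpposite.op x.unop ⊗ₜ 1) := by
      rw [Algebra.TensorProduct.tmul_mul_tmul, one_mul, mul_one, MulOpposite.op_unop]
    rw [descent_tmul, hxy, ← mul_assoc, descent_mul_op, descent_mul_one_tmul, ha, ← mul_assoc,
      ← mul_assoc, Algebra.TensorProduct.tmul_mul_tmul, Algebra.TensorProduct.tmul_mul_tmul,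
      one_mul, one_mul, mul_one, mul_one]

/-- The subalgebra of `Zᵒᵖ ⊗ Z` of elements `x ⊗ y` with
`x y⁽¹⁾ ⊗ y⁽²⁾ ⊗ y⁽³⁾ = 1 ⊗ x ⊗ y`. -/
noncomputable def structureAlgebra : Subalgebra k (Pairs k Z) where
  carrier := {t | Q.descent t = 1 ⊗ₜ t}
  algebraMap_mem' c := by
    rw [Set.mem_ofPred_eq, Algebra.algebraMap_eq_smul_one, map_smul, TensorProduct.tmul_smul,
      Algebra.TensorProduct.one_def, descent_tmul, map_one, mul_one]
    rfl
  add_mem' {a b} ha hb := by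
    rw [Set.mem_ofPred_eq] at *
    rw [map_add, ha, hb, TensorProduct.tmul_add]
  mul_mem' {a b} ha hb := by
    rw [Set.mem_ofPred_eq] at *
    rw [descent_mul _ _ _ ha, hb, Algebra.TensorProduct.tmul_mul_tmul, one_mul]

end QuantumTorsor

/-! ### Bialgebra structure on the structure algebra, and its coaction on Z. -/

namespace QuantumTorsor

variable {k Z : Type*} [Field k] [Ring Z] [Algebra k Z] (Q : QuantumTorsor k Z)

/-- The inclusion of the structure algebra in `Zᵒᵖ ⊗ Z`, as a linear map. -/
noncomputable def incl : Q.structureAlgebra →ₗ[k] Pairs k Z :=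
  Q.structureAlgebra.val.toLinearMap

theorem incl_apply (b : Q.structureAlgebra) : Q.incl b = b := rfl

theorem incl_injective : Function.Injective Q.incl := Subtype.val_injective

theorem exists_incl_eq_iff (t : Pairs k Z) :
    (∃ b, Q.incl b = t) ↔ Q.descent t = TensorProduct.mk k Z (Pairs k Z) 1 t :=
  ⟨fun ⟨b, hb⟩ => hb ▸ b.2, fun h => ⟨⟨t, h⟩, rfl⟩⟩

/-- The coaction of the structure algebra. -/
noncomputable def coact : Z →ₐ[k] Z ⊗[k] Q.structureAlgebra :=
  AlgHom.factorThrough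
    (Algebra.TensorProduct.map (AlgHom.id k Z) Q.structureAlgebra.val)
    (Module.Flat.lTensor_preserves_injective_linearMap Q.incl Q.incl_injective) Q.μ
    fun z => exists_lTensor_eq Z _ _ Q.incl Q.exists_incl_eq_iff (Q.μ z) (Q.lTensor_descent_μ z)

theorem lTensor_incl_coact (z : Z) : Q.incl.lTensor Z (Q.coact z) = Q.μ z :=
  AlgHom.apply_factorThrough
    (Algebra.TensorProduct.map (AlgHom.id k Z) Q.structureAlgebra.val) _ _ _ z

/-- The comultiplication of the structure algebra. -/
noncomputable def comul :
    Q.structureAlgebra →ₐ[k] Q.structureAlgebra ⊗[k] Q.structureAlgebra :=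
  AlgHom.factorThrough
    (Algebra.TensorProduct.map Q.structureAlgebra.val Q.structureAlgebra.val)
    (tensorMap_injective Q.incl Q.incl_injective Q.incl Q.incl_injective)
    ((pairComul Q.μ).comp Q.structureAlgebra.val)
    fun b => exists_map_eq _ _ Q.incl Q.incl_injective Q.exists_incl_eq_iff (Q.ext b)
      (Q.lTensor_descent_ext b) (Q.rTensor_descent_ext b b.2)

theorem map_incl_comul (b : Q.structureAlgebra) :
    TensorProduct.map Q.incl Q.incl (Q.comul b) = Q.ext (Q.incl b) :=
  AlgHom.apply_factorThrough
    (Algebra.TensorProduct.map Q.structureAlgebra.val Q.structureAlgebra.val) _ _ _ b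

/-- Multiply out the last pair in the descent equation. On the left this evaluates `pairMul` ⊗
`pairMul` on `Q.ext t`, which the second torsor axiom simplifies. Over a field the result forces
`pairMul k Z t` to be a scalar. -/
theorem pairMul_tmul_one {t : Pairs k Z} (ht : Q.descent t = 1 ⊗ₜ t) :
    pairMul k Z t ⊗ₜ[k] (1 : Z) = 1 ⊗ₜ pairMul k Z t := by
  have h := congrArg ((pairMul k Z).lTensor Z) ht
  rwa [descent, LinearMap.comp_apply, ← LinearMap.comp_apply, LinearMap.lTensor_comp_rTensor,
    ← LinearMap.rTensor_comp_lTensor, LinearMap.comp_apply, lTensor_pairMul_ext,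
    LinearMap.rTensor_tmul, LinearMap.lTensor_tmul] at h

theorem pairMul_mul (t : Pairs k Z) (x : Zᵐᵒᵖ) (y : Z) :
    pairMul k Z (t * (x ⊗ₜ y)) = x.unop * pairMul k Z t * y := by
  induction t using TensorProduct.induction_on with
  | zero => simp only [zero_mul, map_zero, mul_zero]
  | add a b ha hb => simp only [add_mul, map_add, mul_add, ha, hb]
  | tmul p q =>
    rw [Algebra.TensorProduct.tmul_mul_tmul, pairMul_tmul, pairMul_tmul, MulOpposite.unop_mul]
    simp only [mul_assoc]

theorem pairMul_eq_smul {φ : Z →ₗ[k] k} (hφ : φ 1 = 1) {t : Pairs k Z}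
    (ht : Q.descent t = 1 ⊗ₜ t) : pairMul k Z t = φ (pairMul k Z t) • (1 : Z) := by
  have h := congrArg (fun s => TensorProduct.rid k Z (φ.lTensor Z s)) (Q.pairMul_tmul_one ht)
  simpa [hφ] using h

/-- The counit of the structure algebra, obtained from a linear form on `Z` taking the value `1`
at `1`. It sends `x ⊗ y` to the scalar `x y`. -/
noncomputable def counit (φ : Z →ₗ[k] k) (hφ : φ 1 = 1) : Q.structureAlgebra →ₐ[k] k :=
  AlgHom.ofLinearMap (φ ∘ₗ pairMul k Z ∘ₗ Q.incl)
    (by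
      change φ (pairMul k Z (1 ⊗ₜ 1)) = 1
      rw [pairMul_tmul, MulOpposite.unop_one, one_mul, hφ])
    (fun a b => by
      -- Only a has to satisfy the descent condition: its product is a scalar, so it can be pulled
      -- out from between x and y.
      have h : ∀ t, φ (pairMul k Z (a * t)) = φ (pairMul k Z a) * φ (pairMul k Z t) := fun t => by
        induction t using TensorProduct.induction_on with
        | zero => simp only [mul_zero, map_zero]
        | add s t hs ht => simp only [mul_add, map_add, hs, ht]
        | tmul x y =>
          rw [pairMul_mul, Q.pairMul_eq_smul hφ a.2, map_smul, hφ, pairMul_tmul, mul_smul_comm,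
            mul_one, smul_mul_assoc, map_smul, smul_eq_mul, smul_eq_mul, mul_one]
      exact h b)

theorem algebraMap_counit {φ : Z →ₗ[k] k} (hφ : φ 1 = 1) (b : Q.structureAlgebra) :
    algebraMap k Z (Q.counit φ hφ b) = pairMul k Z b := by
  rw [Q.pairMul_eq_smul hφ b.2, Algebra.algebraMap_eq_smul_one]
  rfl

theorem comul_assoc (b : Q.structureAlgebra) :
    TensorProduct.assoc k _ _ _
      (Q.comul.toLinearMap.rTensor Q.structureAlgebra (Q.comul b)) =
    Q.comul.toLinearMap.lTensor Q.structureAlgebra (Q.comul b) :=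
  coassoc_of_injective Q.incl Q.incl_injective _ Q.ext Q.map_incl_comul b (Q.ext_assoc _)

/-- This is φ applied to the first leg of the descent equation of b; the other counit law is φ
applied to the second torsor axiom. -/
theorem rTensor_counit_comul {φ : Z →ₗ[k] k} (hφ : φ 1 = 1) (b : Q.structureAlgebra) :
    (Q.counit φ hφ).toLinearMap.rTensor Q.structureAlgebra (Q.comul b) = 1 ⊗ₜ b := by
  apply Module.Flat.lTensor_preserves_injective_linearMap Q.incl Q.incl_injective
  have h := congrArg (φ.rTensor (Pairs k Z)) b.2
  rw [descent, LinearMap.comp_apply, ← incl_apply, ← map_incl_comul] at h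
  rw [LinearMap.rTensor_tmul, hφ] at h
  rw [LinearMap.lTensor_tmul, ← h]
  induction Q.comul b using TensorProduct.induction_on with
  | zero => simp only [map_zero]
  | add a b ha hb => simp only [map_add, ha, hb]
  | tmul a b => rfl

theorem lTensor_counit_comul {φ : Z →ₗ[k] k} (hφ : φ 1 = 1) (b : Q.structureAlgebra) :
    (Q.counit φ hφ).toLinearMap.lTensor Q.structureAlgebra (Q.comul b) = b ⊗ₜ 1 := by
  apply Module.Flat.rTensor_preserves_injective_linearMap Q.incl Q.incl_injective
  have h := congrArg (φ.lTensor (Pairs k Z)) (Q.lTensor_pairMul_ext (Q.incl b))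
  rw [← map_incl_comul, LinearMap.lTensor_tmul, hφ] at h
  rw [LinearMap.rTensor_tmul, ← h]
  induction Q.comul b using TensorProduct.induction_on with
  | zero => simp only [map_zero]
  | add a b ha hb => simp only [map_add, ha, hb]
  | tmul a b => rfl

/-- The bialgebra structure of the structure algebra. -/
noncomputable abbrev bialgebra (φ : Z →ₗ[k] k) (hφ : φ 1 = 1) :
    Bialgebra k Q.structureAlgebra :=
  Bialgebra.ofAlgHom Q.comul (Q.counit φ hφ) (AlgHom.ext Q.comul_assoc)
    (AlgHom.ext (Q.rTensor_counit_comul hφ)) (AlgHom.ext (Q.lTensor_counit_comul hφ))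

/-- The structure algebra of a quantum torsor coacts on it from the right. -/
noncomputable def rightComoduleAlgebra (φ : Z →ₗ[k] k) (hφ : φ 1 = 1) :
    letI := Q.bialgebra φ hφ
    RightComoduleAlgebra k Q.structureAlgebra Z :=
  letI := Q.bialgebra φ hφ
  { coact := Q.coact
    coassoc := LinearMap.ext fun z =>
      coact_coassoc_of_injective Q.incl Q.incl_injective Q.comul.toLinearMap Q.ext
        Q.map_incl_comul Q.coact.toLinearMap Q.μ.toLinearMap Q.lTensor_incl_coact z (Q.μ_assoc z)
    counit_coact := LinearMap.ext fun z => by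
      have h := congrArg (fun s => TensorProduct.rid k Z (φ.lTensor Z s)) (Q.lTensor_pairMul_μ z)
      rw [← lTensor_incl_coact, LinearMap.lTensor_tmul, hφ, TensorProduct.rid_tmul, one_smul] at h
      rw [LinearMap.id_apply]
      refine Eq.trans ?_ h
      simp only [LinearMap.comp_apply, LinearEquiv.coe_coe, AlgHom.toLinearMap_apply]
      congr 1
      induction Q.coact z using TensorProduct.induction_on with
      | zero => simp only [map_zero]
      | add a b ha hb => simp only [map_add, ha, hb]
      | tmul a b => rfl }

/-- Both coaction and comultiplication are restrictions of μ on the last leg, so the two sides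
become `Q.ext b` once the last factor is embedded in Zᵒᵖ ⊗ Z. It yields the compatibility of δ with
Δ. -/
theorem assoc_symm_lTensor_coact (b : Q.structureAlgebra) :
    (TensorProduct.assoc k Zᵐᵒᵖ Z Q.structureAlgebra).symm (Q.coact.toLinearMap.lTensor Zᵐᵒᵖ b) =
      Q.incl.rTensor Q.structureAlgebra (Q.comul b) := by
  apply Module.Flat.lTensor_preserves_injective_linearMap Q.incl Q.incl_injective
  have h : ∀ t, Q.incl.lTensor (Pairs k Z) ((TensorProduct.assoc k Zᵐᵒᵖ Z Q.structureAlgebra).symm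
      (Q.coact.toLinearMap.lTensor Zᵐᵒᵖ t)) = Q.ext t := fun t => by
    induction t using TensorProduct.induction_on with
    | zero => simp only [map_zero]
    | add a b ha hb => simp only [map_add, ha, hb]
    | tmul x y =>
      rw [ext_tmul, LinearMap.lTensor_tmul, AlgHom.toLinearMap_apply, ← lTensor_incl_coact]
      induction Q.coact y using TensorProduct.induction_on with
      | zero => simp only [TensorProduct.tmul_zero, map_zero]
      | add a b ha hb => simp only [TensorProduct.tmul_add, map_add, ha, hb]
      | tmul a b => rfl
  rw [h, ← LinearMap.comp_apply, LinearMap.lTensor_comp_rTensor, map_incl_comul]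
  rfl

end QuantumTorsor

/-! ### The antipode of the structure algebra. -/

namespace QuantumTorsor

variable {k Z : Type*} [Field k] [Ring Z] [Algebra k Z] (Q : QuantumTorsor k Z)

/-- The map `x ⊗ y ↦ x⁽¹⁾ y ⊗ x⁽²⁾ ⊗ x⁽³⁾`. -/
noncomputable def shift : Pairs k Z →ₗ[k] Z ⊗[k] Pairs k Z :=
  TensorProduct.lift ((LinearMap.mul k (Z ⊗[k] Pairs k Z)).compl₁₂
    (Q.μ.toLinearMap ∘ₗ (MulOpposite.opLinearEquiv k).symm.toLinearMap)
    Algebra.TensorProduct.includeLeft.toLinearMap)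

theorem shift_tmul (x : Zᵐᵒᵖ) (y : Z) : Q.shift (x ⊗ₜ y) = Q.μ x.unop * (y ⊗ₜ 1) := rfl

/-- The map `x ⊗ y ↦ x⁽¹⁾ y x⁽²⁾ ⊗ x⁽³⁾`, which restricts to the antipode of the structure
algebra. -/
noncomputable def flip : Pairs k Z →ₗ[k] Pairs k Z := collapse k Z ∘ₗ Q.shift

/-- The pair x⁽²⁾ ⊗ x⁽³⁾ already satisfies the descent condition, and the left multiplier x⁽¹⁾ y
passes through `descent`. No condition on t is needed. -/
theorem descent_flip (t : Pairs k Z) : Q.descent (Q.flip t) = Q.shift t := by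
  induction t using TensorProduct.induction_on with
  | zero => simp only [map_zero]
  | add a b ha hb => simp only [map_add, ha, hb]
  | tmul x y =>
    rw [flip, LinearMap.comp_apply, shift_tmul]
    -- E is p ⊗ (q ⊗ s) ↦ p y q ⊗ s.
    let E : Z ⊗[k] (Z ⊗[k] Pairs k Z) →ₗ[k] Z ⊗[k] Pairs k Z :=
      (LinearMap.mul' k Z).rTensor (Pairs k Z) ∘ₗ
        (TensorProduct.assoc k Z Z (Pairs k Z)).symm.toLinearMap ∘ₗ
        (LinearMap.mulRight k y).rTensor _
    have hE : ∀ p (s : Z ⊗[k] Pairs k Z), E (p ⊗ₜ s) = ((p * y) ⊗ₜ 1) * s := fun p s => by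
      induction s using TensorProduct.induction_on with
      | zero => simp only [TensorProduct.tmul_zero, map_zero, mul_zero]
      | add a b ha hb => simp only [TensorProduct.tmul_add, map_add, ha, hb, mul_add]
      | tmul q s => rw [Algebra.TensorProduct.tmul_mul_tmul, one_mul]; rfl
    have h₁ : ∀ v, Q.descent (collapse k Z (v * (y ⊗ₜ 1))) = E (Q.descent.lTensor Z v) :=
      fun v => by
        induction v using TensorProduct.induction_on with
        | zero => simp only [zero_mul, map_zero]
        | add a b ha hb => simp only [add_mul, map_add, ha, hb]
        | tmul p s =>
          rw [Algebra.TensorProduct.tmul_mul_tmul, mul_one, collapse_tmul, descent_mul_op,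
            LinearMap.lTensor_tmul, hE]
    have h₂ : ∀ v, E ((TensorProduct.mk k Z (Pairs k Z) 1).lTensor Z v) = v * (y ⊗ₜ 1) :=
      fun v => by
        induction v using TensorProduct.induction_on with
        | zero => simp only [zero_mul, map_zero]
        | add a b ha hb => simp only [add_mul, map_add, ha, hb]
        | tmul p s =>
          rw [LinearMap.lTensor_tmul, hE, TensorProduct.mk_apply,
            Algebra.TensorProduct.tmul_mul_tmul, Algebra.TensorProduct.tmul_mul_tmul, mul_one,
            mul_one, one_mul]
    rw [h₁, lTensor_descent_μ, h₂]

/-- x⁽¹⁾ y x⁽²⁾ x⁽³⁾ = x y by the second torsor axiom. -/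
theorem pairMul_flip (t : Pairs k Z) : pairMul k Z (Q.flip t) = pairMul k Z t := by
  induction t using TensorProduct.induction_on with
  | zero => simp only [map_zero]
  | add a b ha hb => simp only [map_add, ha, hb]
  | tmul x y =>
    rw [flip, LinearMap.comp_apply, shift_tmul]
    have h : ∀ v, pairMul k Z (collapse k Z (v * (y ⊗ₜ 1))) =
        LinearMap.mul' k Z ((LinearMap.mulRight k y).rTensor Z ((pairMul k Z).lTensor Z v)) :=
      fun v => by
        induction v using TensorProduct.induction_on with
        | zero => simp only [zero_mul, map_zero]
        | add a b ha hb => simp only [add_mul, map_add, ha, hb]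
        | tmul p s =>
          rw [Algebra.TensorProduct.tmul_mul_tmul, mul_one, collapse_tmul, pairMul_mul,
            MulOpposite.unop_op, mul_one, LinearMap.lTensor_tmul, LinearMap.rTensor_tmul,
            LinearMap.mul'_apply, LinearMap.mulRight_apply]
    rw [h, lTensor_pairMul_μ, LinearMap.rTensor_tmul, LinearMap.mul'_apply,
      LinearMap.mulRight_apply, mul_one, pairMul_tmul]

/-- The left side is x⁽¹⁾ y⁽¹⁾ y⁽²⁾ x⁽²⁾ ⊗ x⁽³⁾ y⁽³⁾. The first torsor axiom, for y and then for x,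
contracts it to 1 ⊗ x y. -/
theorem collapse_shift_ext (t : Pairs k Z) :
    collapse k Z ((LinearMap.mul' k (Pairs k Z)).lTensor Z
      (TensorProduct.assoc k Z (Pairs k Z) (Pairs k Z)
        (Q.shift.rTensor (Pairs k Z) (Q.ext t)))) = 1 ⊗ₜ pairMul k Z t := by
  induction t using TensorProduct.induction_on with
  | zero => simp only [map_zero, TensorProduct.tmul_zero]
  | add a b ha hb => simp only [map_add, TensorProduct.tmul_add, ha, hb]
  | tmul x y =>
    have h₁ : ∀ (v : Z ⊗[k] Pairs k Z) (q : Z) (c : Pairs k Z),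
        collapse k Z ((LinearMap.mul' k (Pairs k Z)).lTensor Z
          (TensorProduct.assoc k Z (Pairs k Z) (Pairs k Z) ((v * (q ⊗ₜ 1)) ⊗ₜ c))) =
        collapse k Z (v * (1 ⊗ₜ collapse k Z (q ⊗ₜ c))) := fun v q c => by
      induction v using TensorProduct.induction_on with
      | zero => simp only [zero_mul, map_zero, TensorProduct.zero_tmul]
      | add a b ha hb => simp only [add_mul, map_add, TensorProduct.add_tmul, ha, hb]
      | tmul p b =>
        rw [Algebra.TensorProduct.tmul_mul_tmul, Algebra.TensorProduct.tmul_mul_tmul,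
          TensorProduct.assoc_tmul, LinearMap.lTensor_tmul, LinearMap.mul'_apply, collapse_tmul,
          collapse_tmul, collapse_tmul, mul_one, mul_one, mul_assoc, mul_assoc, mul_assoc,
          Algebra.TensorProduct.tmul_mul_tmul, mul_one, MulOpposite.op_mul]
    have h₂ : ∀ w : Z ⊗[k] Pairs k Z,
        collapse k Z ((LinearMap.mul' k (Pairs k Z)).lTensor Z
          (TensorProduct.assoc k Z (Pairs k Z) (Pairs k Z) (Q.shift.rTensor (Pairs k Z)
            ((TensorProduct.assoc k Zᵐᵒᵖ Z (Pairs k Z)).symm (x ⊗ₜ w))))) =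
        collapse k Z (Q.μ x.unop * (1 ⊗ₜ collapse k Z w)) := fun w => by
      induction w using TensorProduct.induction_on with
      | zero => simp only [map_zero, TensorProduct.tmul_zero, mul_zero]
      | add a b ha hb => simp only [map_add, TensorProduct.tmul_add, mul_add, ha, hb]
      | tmul q c =>
        rw [TensorProduct.assoc_symm_tmul, LinearMap.rTensor_tmul, shift_tmul, h₁]
    have h₃ : ∀ v : Z ⊗[k] Pairs k Z,
        collapse k Z (v * (1 ⊗ₜ (1 ⊗ₜ y))) = collapse k Z v * (1 ⊗ₜ y) := fun v => by
      induction v using TensorProduct.induction_on with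
      | zero => simp only [zero_mul, map_zero]
      | add a b ha hb => simp only [add_mul, map_add, ha, hb]
      | tmul p b =>
        rw [Algebra.TensorProduct.tmul_mul_tmul, collapse_tmul, collapse_tmul, mul_one, mul_assoc,
          mul_assoc, Algebra.TensorProduct.tmul_mul_tmul, Algebra.TensorProduct.tmul_mul_tmul,
          one_mul, one_mul, mul_one, mul_one]
    rw [ext_tmul, h₂, collapse_μ, h₃, collapse_μ, Algebra.TensorProduct.tmul_mul_tmul, one_mul,
      pairMul_tmul]

/-- The map `x ⊗ y ↦ θ y ⊗ x`. -/
noncomputable def twist (θ : Z →ₗ[k] Z) : Pairs k Z →ₗ[k] Pairs k Z :=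
  TensorProduct.map ((MulOpposite.opLinearEquiv k).toLinearMap ∘ₗ θ)
    (MulOpposite.opLinearEquiv k).symm.toLinearMap ∘ₗ (TensorProduct.comm k Zᵐᵒᵖ Z).toLinearMap

theorem twist_tmul (θ : Z →ₗ[k] Z) (x : Zᵐᵒᵖ) (y : Z) :
    twist θ (x ⊗ₜ y) = MulOpposite.op (θ y) ⊗ₜ x.unop := rfl

/-- The left side is θ(y⁽³⁾) x ⊗ y⁽¹⁾ y⁽²⁾, which the first torsor axiom contracts to θ(y) x ⊗ 1. -/
theorem mul_twist_ext (θ : Z →ₗ[k] Z) (t : Pairs k Z) :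
    LinearMap.mul' k (Pairs k Z) ((twist θ).lTensor (Pairs k Z) (Q.ext t)) =
      MulOpposite.op (pairMul k Z (twist θ t)) ⊗ₜ 1 := by
  induction t using TensorProduct.induction_on with
  | zero => simp only [map_zero, MulOpposite.op_zero, TensorProduct.zero_tmul]
  | add a b ha hb => simp only [map_add, MulOpposite.op_add, TensorProduct.add_tmul, ha, hb]
  | tmul x y =>
    have h : ∀ w : Z ⊗[k] Pairs k Z,
        LinearMap.mul' k (Pairs k Z) ((twist θ).lTensor (Pairs k Z)
          ((TensorProduct.assoc k Zᵐᵒᵖ Z (Pairs k Z)).symm (x ⊗ₜ w))) =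
        (x ⊗ₜ 1) * twist θ (collapse k Z w) := fun w => by
      induction w using TensorProduct.induction_on with
      | zero => simp only [map_zero, TensorProduct.tmul_zero, mul_zero]
      | add a b ha hb => simp only [map_add, TensorProduct.tmul_add, mul_add, ha, hb]
      | tmul p s =>
        rw [TensorProduct.assoc_symm_tmul, LinearMap.lTensor_tmul, LinearMap.mul'_apply,
          collapse_tmul]
        induction s using TensorProduct.induction_on with
        | zero => simp only [map_zero, zero_mul, mul_zero]
        | add a b ha hb => simp only [map_add, add_mul, mul_add, ha, hb]
        | tmul q r =>
          rw [Algebra.TensorProduct.tmul_mul_tmul, twist_tmul, twist_tmul,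
            Algebra.TensorProduct.tmul_mul_tmul, Algebra.TensorProduct.tmul_mul_tmul, mul_one,
            one_mul, MulOpposite.unop_mul, MulOpposite.unop_op]
    rw [ext_tmul, h, collapse_μ, twist_tmul, twist_tmul, Algebra.TensorProduct.tmul_mul_tmul,
      pairMul_tmul, MulOpposite.unop_op, MulOpposite.unop_one, one_mul, MulOpposite.op_mul,
      MulOpposite.op_unop]

/-- The antipode of the structure algebra. -/
noncomputable def antipode (hK : ∀ t, Q.descent t = 1 ⊗ₜ t → Q.shift t = 1 ⊗ₜ Q.flip t) :
    Q.structureAlgebra →ₗ[k] Q.structureAlgebra where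
  toFun b := ⟨Q.flip b, (Q.descent_flip b).trans (hK b b.2)⟩
  map_add' a b := Subtype.ext (Q.flip.map_add a b)
  map_smul' c a := Subtype.ext (Q.flip.map_smul c a)

/-- On the structure algebra `hK` allows `flip` to be replaced by `shift`, for which
`collapse_shift_ext` computes the product. -/
theorem mul_antipode_rTensor (hK : ∀ t, Q.descent t = 1 ⊗ₜ t → Q.shift t = 1 ⊗ₜ Q.flip t)
    {φ : Z →ₗ[k] k} (hφ : φ 1 = 1) (b : Q.structureAlgebra) :
    LinearMap.mul' k Q.structureAlgebra
      ((Q.antipode hK).rTensor Q.structureAlgebra (Q.comul b)) =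
    algebraMap k Q.structureAlgebra (Q.counit φ hφ b) := by
  apply Q.incl_injective
  have h : ∀ s, Q.incl (LinearMap.mul' k Q.structureAlgebra
      ((Q.antipode hK).rTensor Q.structureAlgebra s)) =
      collapse k Z ((LinearMap.mul' k (Pairs k Z)).lTensor Z
        (TensorProduct.assoc k Z (Pairs k Z) (Pairs k Z)
          (Q.shift.rTensor (Pairs k Z) (TensorProduct.map Q.incl Q.incl s)))) := fun s => by
    induction s using TensorProduct.induction_on with
    | zero => simp only [map_zero]
    | add a b ha hb => simp only [map_add, ha, hb]
    | tmul a b =>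
      rw [TensorProduct.map_tmul, LinearMap.rTensor_tmul, LinearMap.rTensor_tmul, Q.incl_apply a,
        hK a a.2, TensorProduct.assoc_tmul, LinearMap.lTensor_tmul, collapse_tmul,
        MulOpposite.op_one, ← Algebra.TensorProduct.one_def, mul_one]
      rfl
  rw [h, map_incl_comul, collapse_shift_ext, incl_apply, ← Q.algebraMap_counit hφ]
  exact (Algebra.TensorProduct.algebraMap_apply' _).symm

/-- Here `flip` is replaced by `twist θ`, for which `mul_twist_ext` applies; `pairMul_flip` then
identifies the scalar with the counit. -/
theorem mul_antipode_lTensor (hK : ∀ t, Q.descent t = 1 ⊗ₜ t → Q.shift t = 1 ⊗ₜ Q.flip t)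
    {θ : Z →ₗ[k] Z} (hθ : ∀ t, Q.descent t = 1 ⊗ₜ t → Q.flip t = twist θ t)
    {φ : Z →ₗ[k] k} (hφ : φ 1 = 1) (b : Q.structureAlgebra) :
    LinearMap.mul' k Q.structureAlgebra
      ((Q.antipode hK).lTensor Q.structureAlgebra (Q.comul b)) =
    algebraMap k Q.structureAlgebra (Q.counit φ hφ b) := by
  apply Q.incl_injective
  have h : ∀ s, Q.incl (LinearMap.mul' k Q.structureAlgebra
      ((Q.antipode hK).lTensor Q.structureAlgebra s)) =
      LinearMap.mul' k (Pairs k Z)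
        ((twist θ).lTensor (Pairs k Z) (TensorProduct.map Q.incl Q.incl s)) := fun s => by
    induction s using TensorProduct.induction_on with
    | zero => simp only [map_zero]
    | add a b ha hb => simp only [map_add, ha, hb]
    | tmul a b =>
      rw [TensorProduct.map_tmul, LinearMap.lTensor_tmul, LinearMap.lTensor_tmul, Q.incl_apply b,
        ← hθ b b.2]
      rfl
  rw [h, map_incl_comul, mul_twist_ext, incl_apply, ← hθ b b.2, pairMul_flip,
    ← Q.algebraMap_counit hφ]
  rfl

/-- The structure algebra is a Hopf algebra when `flip` provides an antipode. -/
noncomputable abbrev hopfAlgebra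
    (hK : ∀ t, Q.descent t = 1 ⊗ₜ t → Q.shift t = 1 ⊗ₜ Q.flip t)
    (θ : Z →ₗ[k] Z) (hθ : ∀ t, Q.descent t = 1 ⊗ₜ t → Q.flip t = twist θ t)
    (φ : Z →ₗ[k] k) (hφ : φ 1 = 1) : HopfAlgebra k Q.structureAlgebra :=
  { Q.bialgebra φ hφ with
    antipode := Q.antipode hK
    mul_antipode_rTensor_comul := LinearMap.ext (Q.mul_antipode_rTensor hK hφ)
    mul_antipode_lTensor_comul := LinearMap.ext (Q.mul_antipode_lTensor hK hθ hφ) }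

end QuantumTorsor

/-! ### The quantum torsor of a Galois extension. -/

/-- Both sides are τ ⊗ τ ⊗ 1, regrouped, applied to the two sides of coassociativity of α; `hτ`
turns α on the first leg of τ into D. -/
theorem extendLeft_assoc_of_coact {k A V Z : Type*} [Field k] [AddCommGroup A] [Module k A]
    [AddCommGroup V] [Module k V] [AddCommGroup Z] [Module k Z] (α : Z →ₗ[k] A ⊗[k] Z)
    (D : A →ₗ[k] A ⊗[k] A) (τ : A →ₗ[k] Z ⊗[k] V)
    (hα : ∀ z, TensorProduct.assoc k A A Z (D.rTensor Z (α z)) = α.lTensor A (α z))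
    (hτ : ∀ a, TensorProduct.assoc k A Z V (α.rTensor V (τ a)) = τ.lTensor A (D a))
    (m : Z →ₗ[k] Z ⊗[k] (V ⊗[k] Z))
    (hm : ∀ z, m z = TensorProduct.assoc k Z V Z (τ.rTensor Z (α z))) (z : Z) :
    TensorProduct.assoc k Z (V ⊗[k] Z) (V ⊗[k] Z) (m.rTensor (V ⊗[k] Z) (m z)) =
      (extendLeft m).lTensor Z (m z) := by
  let Y : (Z ⊗[k] V) ⊗[k] ((Z ⊗[k] V) ⊗[k] Z) →ₗ[k] Z ⊗[k] ((V ⊗[k] Z) ⊗[k] (V ⊗[k] Z)) :=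
    ((TensorProduct.assoc k V Z (V ⊗[k] Z)).symm.toLinearMap ∘ₗ
      (TensorProduct.assoc k Z V Z).toLinearMap.lTensor V).lTensor Z ∘ₗ
      (TensorProduct.assoc k Z V _).toLinearMap
  have hY : ∀ p q t, Y ((p ⊗ₜ q) ⊗ₜ t) = p ⊗ₜ
      (TensorProduct.assoc k V Z (V ⊗[k] Z)).symm (q ⊗ₜ TensorProduct.assoc k Z V Z t) :=
    fun _ _ _ => rfl
  have hl : ∀ s w, TensorProduct.assoc k Z (V ⊗[k] Z) (V ⊗[k] Z)
      (m.rTensor (V ⊗[k] Z) (TensorProduct.assoc k Z V Z (s ⊗ₜ w))) =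
      Y (τ.rTensor _ (TensorProduct.assoc k A (Z ⊗[k] V) Z
        (TensorProduct.assoc k A Z V (α.rTensor V s) ⊗ₜ w))) := fun s w => by
    induction s using TensorProduct.induction_on with
    | zero => simp
    | add a b ha hb => simp only [map_add, TensorProduct.add_tmul, ha, hb]
    | tmul p q =>
      rw [TensorProduct.assoc_tmul, LinearMap.rTensor_tmul, LinearMap.rTensor_tmul, hm]
      induction α p using TensorProduct.induction_on with
      | zero => simp
      | add a b ha hb => simp only [map_add, TensorProduct.add_tmul, ha, hb]
      | tmul b p' =>
        simp only [TensorProduct.assoc_tmul, LinearMap.rTensor_tmul]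
        induction τ b using TensorProduct.induction_on with
        | zero => simp
        | add a b ha hb => simp only [map_add, TensorProduct.add_tmul, ha, hb]
        | tmul x y => simp [hY]
  have hl' : ∀ v, TensorProduct.assoc k Z (V ⊗[k] Z) (V ⊗[k] Z)
      (m.rTensor (V ⊗[k] Z) (TensorProduct.assoc k Z V Z (τ.rTensor Z v))) =
      Y (TensorProduct.map τ (τ.rTensor Z) (TensorProduct.assoc k A A Z (D.rTensor Z v))) :=
    fun v => by
      induction v using TensorProduct.induction_on with
      | zero => simp
      | add a b ha hb => simp only [map_add, ha, hb]
      | tmul a w =>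
        rw [LinearMap.rTensor_tmul, LinearMap.rTensor_tmul, hl, hτ]
        congr 1
        induction D a using TensorProduct.induction_on with
        | zero => simp
        | add a b ha hb => simp only [map_add, TensorProduct.add_tmul, ha, hb]
        | tmul b c => simp
  have hr : ∀ v, (extendLeft m).lTensor Z (TensorProduct.assoc k Z V Z (τ.rTensor Z v)) =
      Y (TensorProduct.map τ (τ.rTensor Z) (α.lTensor A v)) := fun v => by
    induction v using TensorProduct.induction_on with
    | zero => simp
    | add a b ha hb => simp only [map_add, ha, hb]
    | tmul a w =>
      rw [LinearMap.rTensor_tmul, LinearMap.lTensor_tmul, TensorProduct.map_tmul]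
      induction τ a using TensorProduct.induction_on with
      | zero => simp
      | add a b ha hb => simp only [map_add, TensorProduct.add_tmul, ha, hb]
      | tmul p q =>
        rw [TensorProduct.assoc_tmul, LinearMap.lTensor_tmul, extendLeft_tmul, hm, hY]
  rw [hm z, hl', hr, hα]

namespace LeftComoduleAlgebra

variable {k A Z : Type*} [Field k] [Ring A] [HopfAlgebra k A] [Ring Z] [Algebra k Z]
  (L : LeftComoduleAlgebra k A Z)

theorem galoisMap_tmul (x y : Z) : L.galoisMap (x ⊗ₜ y) = L.coact x * (1 ⊗ₜ y) := by
  have h : ∀ s : A ⊗[k] Z, (LinearMap.mul' k Z).lTensor A (TensorProduct.assoc k A Z Z (s ⊗ₜ y)) =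
      s * (1 ⊗ₜ y) := fun s => by
    induction s using TensorProduct.induction_on with
    | zero => simp only [TensorProduct.zero_tmul, map_zero, zero_mul]
    | add a b ha hb => simp only [TensorProduct.add_tmul, map_add, add_mul, ha, hb]
    | tmul a z => rw [Algebra.TensorProduct.tmul_mul_tmul, mul_one]; rfl
  exact h _

theorem coassoc_apply (z : Z) : TensorProduct.assoc k A A Z
    ((Coalgebra.comul (R := k) (A := A)).rTensor Z (L.coact z)) =
    L.coact.toLinearMap.lTensor A (L.coact z) :=
  LinearMap.congr_fun L.coassoc z

theorem counit_coact_apply (z : Z) : TensorProduct.lid k Z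
    ((Coalgebra.counit (R := k) (A := A)).rTensor Z (L.coact z)) = z :=
  LinearMap.congr_fun L.counit_coact z

variable (hL : Function.Bijective L.galoisMap)

/-- The Galois map as a linear equivalence `Z ⊗ Zᵒᵖ ≃ A ⊗ Z`. -/
noncomputable def galoisEquiv : Z ⊗[k] Zᵐᵒᵖ ≃ₗ[k] A ⊗[k] Z :=
  (MulOpposite.opLinearEquiv k).symm.lTensor Z ≪≫ₗ LinearEquiv.ofBijective L.galoisMap hL

theorem galoisEquiv_tmul (x : Z) (y : Zᵐᵒᵖ) :
    L.galoisEquiv hL (x ⊗ₜ y) = L.coact x * (1 ⊗ₜ y.unop) := L.galoisMap_tmul x y.unop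

theorem galoisEquiv_tmul_mul (x : Z) (y : Zᵐᵒᵖ) (s : Z ⊗[k] Zᵐᵒᵖ) :
    L.galoisEquiv hL ((x ⊗ₜ y) * s) = L.coact x * L.galoisEquiv hL s * (1 ⊗ₜ y.unop) := by
  induction s using TensorProduct.induction_on with
  | zero => simp only [map_zero, mul_zero, zero_mul]
  | add a b ha hb => simp only [map_add, mul_add, add_mul, ha, hb]
  | tmul p q =>
    rw [Algebra.TensorProduct.tmul_mul_tmul, galoisEquiv_tmul, galoisEquiv_tmul, map_mul,
      mul_assoc, mul_assoc, mul_assoc, Algebra.TensorProduct.tmul_mul_tmul, one_mul,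
      MulOpposite.unop_mul]

/-- The element b ⊗ 1 commutes with 1 ⊗ y, so it passes to the far right. Multiplicativity of the
translation map follows. -/
theorem galoisEquiv_mul (t s : Z ⊗[k] Zᵐᵒᵖ) (b : A) (hs : L.galoisEquiv hL s = b ⊗ₜ 1) :
    L.galoisEquiv hL (t * s) = L.galoisEquiv hL t * (b ⊗ₜ 1) := by
  induction t using TensorProduct.induction_on with
  | zero => simp only [map_zero, zero_mul]
  | add a b ha hb => simp only [map_add, add_mul, ha, hb]
  | tmul x y =>
    rw [galoisEquiv_tmul_mul, hs, galoisEquiv_tmul, mul_assoc, mul_assoc,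
      Algebra.TensorProduct.tmul_mul_tmul, Algebra.TensorProduct.tmul_mul_tmul]
    simp only [one_mul, mul_one]

/-- The translation map `a ↦ κ⁻¹ (a ⊗ 1)`. -/
noncomputable def translation : A →ₐ[k] Z ⊗[k] Zᵐᵒᵖ :=
  AlgHom.ofLinearMap ((L.galoisEquiv hL).symm.toLinearMap ∘ₗ (TensorProduct.mk k A Z).flip 1)
    (by
      apply (L.galoisEquiv hL).injective
      simp only [LinearMap.comp_apply, LinearEquiv.coe_coe, LinearEquiv.apply_symm_apply,
        LinearMap.flip_apply, TensorProduct.mk_apply]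
      rw [Algebra.TensorProduct.one_def, galoisEquiv_tmul, map_one, one_mul, MulOpposite.unop_one])
    (fun a b => by
      apply (L.galoisEquiv hL).injective
      rw [L.galoisEquiv_mul hL _ _ b]
      all_goals simp only [LinearMap.comp_apply, LinearEquiv.coe_coe, LinearEquiv.apply_symm_apply,
        LinearMap.flip_apply, TensorProduct.mk_apply]
      rw [Algebra.TensorProduct.tmul_mul_tmul, one_mul])

theorem galoisEquiv_translation (a : A) :
    L.galoisEquiv hL (L.translation hL a) = a ⊗ₜ 1 :=
  (L.galoisEquiv hL).apply_symm_apply _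

/-- By the counit law of α, (ε ⊗ 1) ∘ κ is multiplication; evaluate at κ⁻¹(a ⊗ 1). -/
theorem mul_translation (a : A) :
    LinearMap.mul' k Z ((MulOpposite.opLinearEquiv k).symm.toLinearMap.lTensor Z
      (L.translation hL a)) = algebraMap k Z (Coalgebra.counit a) := by
  have h : ∀ s, LinearMap.mul' k Z ((MulOpposite.opLinearEquiv k).symm.toLinearMap.lTensor Z s) =
      TensorProduct.lid k Z ((Coalgebra.counit (R := k) (A := A)).rTensor Z
        (L.galoisEquiv hL s)) := fun s => by
    induction s using TensorProduct.induction_on with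
    | zero => simp only [map_zero]
    | add a b ha hb => simp only [map_add, ha, hb]
    | tmul x y =>
      have h' : ∀ v : A ⊗[k] Z, TensorProduct.lid k Z ((Coalgebra.counit (R := k) (A := A)).rTensor Z
          (v * (1 ⊗ₜ y.unop))) =
          TensorProduct.lid k Z ((Coalgebra.counit (R := k) (A := A)).rTensor Z v) * y.unop :=
        fun v => by
          induction v using TensorProduct.induction_on with
          | zero => simp only [zero_mul, map_zero]
          | add a b ha hb => simp only [add_mul, map_add, ha, hb]
          | tmul a z =>
            rw [Algebra.TensorProduct.tmul_mul_tmul, LinearMap.rTensor_tmul,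
              LinearMap.rTensor_tmul, TensorProduct.lid_tmul, TensorProduct.lid_tmul, mul_one,
              smul_mul_assoc]
      rw [galoisEquiv_tmul, h', counit_coact_apply]
      rfl
  rw [h, galoisEquiv_translation, LinearMap.rTensor_tmul, TensorProduct.lid_tmul,
    Algebra.algebraMap_eq_smul_one]

/-- Coassociativity makes κ intertwine α on the first leg with Δ on A, so the identity holds after
applying 1 ⊗ κ. -/
theorem coact_translation (a : A) :
    TensorProduct.assoc k A Z Zᵐᵒᵖ (L.coact.toLinearMap.rTensor Zᵐᵒᵖ (L.translation hL a)) =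
      (L.translation hL).toLinearMap.lTensor A (Coalgebra.comul (R := k) a) := by
  apply ((L.galoisEquiv hL).lTensor A).injective
  have h : ∀ s, (L.galoisEquiv hL).lTensor A
      (TensorProduct.assoc k A Z Zᵐᵒᵖ (L.coact.toLinearMap.rTensor Zᵐᵒᵖ s)) =
      TensorProduct.assoc k A A Z ((Coalgebra.comul (R := k) (A := A)).rTensor Z
        (L.galoisEquiv hL s)) := fun s => by
    induction s using TensorProduct.induction_on with
    | zero => simp only [map_zero]
    | add a b ha hb => simp only [map_add, ha, hb]
    | tmul x y =>
      have h₁ : ∀ v : A ⊗[k] Z, (L.galoisEquiv hL).lTensor A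
          (TensorProduct.assoc k A Z Zᵐᵒᵖ (v ⊗ₜ y)) =
          (LinearMap.mulRight k (1 ⊗ₜ y.unop)).lTensor A (L.coact.toLinearMap.lTensor A v) :=
        fun v => by
          induction v using TensorProduct.induction_on with
          | zero => simp only [TensorProduct.zero_tmul, map_zero]
          | add a b ha hb => simp only [TensorProduct.add_tmul, map_add, ha, hb]
          | tmul c w =>
            rw [TensorProduct.assoc_tmul, LinearEquiv.lTensor_tmul, galoisEquiv_tmul]
            rfl
      have h₂ : ∀ v : A ⊗[k] Z, TensorProduct.assoc k A A Z
          ((Coalgebra.comul (R := k) (A := A)).rTensor Z (v * (1 ⊗ₜ y.unop))) =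
          (LinearMap.mulRight k (1 ⊗ₜ y.unop)).lTensor A (TensorProduct.assoc k A A Z
            ((Coalgebra.comul (R := k) (A := A)).rTensor Z v)) := fun v => by
        induction v using TensorProduct.induction_on with
        | zero => simp only [zero_mul, map_zero]
        | add a b ha hb => simp only [add_mul, map_add, ha, hb]
        | tmul c w =>
          rw [Algebra.TensorProduct.tmul_mul_tmul, LinearMap.rTensor_tmul, LinearMap.rTensor_tmul,
            mul_one]
          induction Coalgebra.comul (R := k) c using TensorProduct.induction_on with
          | zero => simp only [TensorProduct.zero_tmul, map_zero]
          | add a b ha hb => simp only [TensorProduct.add_tmul, map_add, ha, hb]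
          | tmul c d =>
            rw [TensorProduct.assoc_tmul, TensorProduct.assoc_tmul, LinearMap.lTensor_tmul,
              LinearMap.mulRight_apply, Algebra.TensorProduct.tmul_mul_tmul, mul_one]
      rw [LinearMap.rTensor_tmul, AlgHom.toLinearMap_apply, h₁, galoisEquiv_tmul, h₂,
        coassoc_apply]
  rw [h, galoisEquiv_translation, LinearMap.rTensor_tmul]
  induction Coalgebra.comul (R := k) a using TensorProduct.induction_on with
  | zero => simp only [TensorProduct.zero_tmul, map_zero]
  | add a b ha hb => simp only [TensorProduct.add_tmul, map_add, ha, hb]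
  | tmul c d =>
    rw [TensorProduct.assoc_tmul, LinearMap.lTensor_tmul, LinearEquiv.lTensor_tmul,
      AlgHom.toLinearMap_apply, galoisEquiv_translation]

/-- The map `z ↦ κ⁻¹ (z₍₋₁₎ ⊗ 1) ⊗ z₍₀₎`. -/
noncomputable def torsorMap : Z →ₐ[k] Z ⊗[k] Pairs k Z :=
  (Algebra.TensorProduct.assoc k k k Z Zᵐᵒᵖ Z).toAlgHom.comp
    ((Algebra.TensorProduct.map (L.translation hL) (AlgHom.id k Z)).comp L.coact)

theorem torsorMap_apply (z : Z) : L.torsorMap hL z = TensorProduct.assoc k Z Zᵐᵒᵖ Z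
    ((L.translation hL).toLinearMap.rTensor Z (L.coact z)) := rfl

/-- A Galois extension of the base field is a quantum torsor. -/
noncomputable def quantumTorsor : QuantumTorsor k Z where
  μ := L.torsorMap hL
  collapse_μ z := by
    have h₁ : ∀ s w, collapse k Z (TensorProduct.assoc k Z Zᵐᵒᵖ Z (s ⊗ₜ w)) =
        MulOpposite.op (LinearMap.mul' k Z
          ((MulOpposite.opLinearEquiv k).symm.toLinearMap.lTensor Z s)) ⊗ₜ w := fun s w => by
      induction s using TensorProduct.induction_on with
      | zero => simp only [TensorProduct.zero_tmul, map_zero, MulOpposite.op_zero]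
      | add a b ha hb => simp only [TensorProduct.add_tmul, map_add, MulOpposite.op_add, ha, hb]
      | tmul p q =>
        rw [TensorProduct.assoc_tmul, collapse_tmul, Algebra.TensorProduct.tmul_mul_tmul, mul_one]
        rfl
    have h₂ : ∀ v : A ⊗[k] Z, collapse k Z (TensorProduct.assoc k Z Zᵐᵒᵖ Z
        ((L.translation hL).toLinearMap.rTensor Z v)) =
        1 ⊗ₜ TensorProduct.lid k Z ((Coalgebra.counit (R := k) (A := A)).rTensor Z v) :=
      fun v => by
        induction v using TensorProduct.induction_on with
        | zero => simp only [map_zero, TensorProduct.tmul_zero]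
        | add a b ha hb => simp only [map_add, TensorProduct.tmul_add, ha, hb]
        | tmul a w =>
          rw [LinearMap.rTensor_tmul, h₁, AlgHom.toLinearMap_apply, mul_translation,
            LinearMap.rTensor_tmul, TensorProduct.lid_tmul, Algebra.algebraMap_eq_smul_one,
            MulOpposite.op_smul, TensorProduct.smul_tmul, MulOpposite.op_one]
    rw [torsorMap_apply, h₂, counit_coact_apply]
  lTensor_pairMul_μ z := by
    -- After κ, both sides are α z.
    apply hL.1
    have h₁ : ∀ s w, L.galoisMap ((pairMul k Z).lTensor Z (TensorProduct.assoc k Z Zᵐᵒᵖ Z (s ⊗ₜ w))) =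
        L.galoisEquiv hL s * (1 ⊗ₜ w) := fun s w => by
      induction s using TensorProduct.induction_on with
      | zero => simp only [TensorProduct.zero_tmul, map_zero, zero_mul]
      | add a b ha hb => simp only [TensorProduct.add_tmul, map_add, add_mul, ha, hb]
      | tmul p q =>
        rw [TensorProduct.assoc_tmul, LinearMap.lTensor_tmul, pairMul_tmul, galoisMap_tmul,
          galoisEquiv_tmul, mul_assoc, Algebra.TensorProduct.tmul_mul_tmul, mul_one]
    have h₂ : ∀ v : A ⊗[k] Z, L.galoisMap ((pairMul k Z).lTensor Z (TensorProduct.assoc k Z Zᵐᵒᵖ Z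
        ((L.translation hL).toLinearMap.rTensor Z v))) = v := fun v => by
      induction v using TensorProduct.induction_on with
      | zero => simp only [map_zero]
      | add a b ha hb => simp only [map_add, ha, hb]
      | tmul a w =>
        rw [LinearMap.rTensor_tmul, h₁, AlgHom.toLinearMap_apply, galoisEquiv_translation,
          Algebra.TensorProduct.tmul_mul_tmul, mul_one, one_mul]
    rw [torsorMap_apply, h₂, galoisMap_tmul, ← Algebra.TensorProduct.one_def, mul_one]
  μ_assoc := extendLeft_assoc_of_coact L.coact.toLinearMap Coalgebra.comul
    (L.translation hL).toLinearMap L.coassoc_apply (L.coact_translation hL)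
    (L.torsorMap hL).toLinearMap (L.torsorMap_apply hL)

end LeftComoduleAlgebra

/-! ### The antipode conditions for a Galois extension. -/

namespace LeftComoduleAlgebra

variable {k A Z : Type*} [Field k] [Ring A] [HopfAlgebra k A] [Ring Z] [Algebra k Z]
  (L : LeftComoduleAlgebra k A Z) (hL : Function.Bijective L.galoisMap)

/-- The action `a ▷ y = a⁽¹⁾ y a⁽²⁾` of `A` on `Z` (Miyashita-Ulbrich), where `a⁽¹⁾ ⊗ a⁽²⁾` is the
image of `a` under the translation map. -/
noncomputable def adAction : A →ₗ[k] Module.End k Z :=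
  (AlgHom.mulLeftRight k Z).toLinearMap ∘ₗ (L.translation hL).toLinearMap

/-- The map `(a ⊗ x) ⊗ y ↦ (a ▷ y) ⊗ x`. -/
noncomputable def adSwap : (A ⊗[k] Z) ⊗[k] Z →ₗ[k] Z ⊗[k] Z :=
  (TensorProduct.lift (L.adAction hL)).rTensor Z ∘ₗ (TensorProduct.rightComm k A Z Z).toLinearMap

theorem adSwap_tmul (a : A) (x y : Z) :
    L.adSwap hL ((a ⊗ₜ x) ⊗ₜ y) = L.adAction hL a y ⊗ₜ x := rfl

theorem flip_tmul (x : Zᵐᵒᵖ) (y : Z) : (L.quantumTorsor hL).flip (x ⊗ₜ y) =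
    (MulOpposite.opLinearEquiv k).toLinearMap.rTensor Z
      (L.adSwap hL (L.coact x.unop ⊗ₜ y)) := by
  have h₁ : ∀ s w, collapse k Z (TensorProduct.assoc k Z Zᵐᵒᵖ Z (s ⊗ₜ w) * (y ⊗ₜ 1)) =
      MulOpposite.op (AlgHom.mulLeftRight k Z s y) ⊗ₜ w := fun s w => by
    induction s using TensorProduct.induction_on with
    | zero => simp only [TensorProduct.zero_tmul, map_zero, zero_mul, LinearMap.zero_apply,
        MulOpposite.op_zero]
    | add a b ha hb => simp only [TensorProduct.add_tmul, map_add, add_mul, ha, hb,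
        LinearMap.add_apply, MulOpposite.op_add]
    | tmul p q =>
      rw [TensorProduct.assoc_tmul, Algebra.TensorProduct.tmul_mul_tmul, mul_one, collapse_tmul,
        Algebra.TensorProduct.tmul_mul_tmul, mul_one, AlgHom.mulLeftRight_apply,
        MulOpposite.op_mul (p * y), MulOpposite.op_mul, MulOpposite.op_unop]
  have h₂ : ∀ v : A ⊗[k] Z, collapse k Z (TensorProduct.assoc k Z Zᵐᵒᵖ Z
      ((L.translation hL).toLinearMap.rTensor Z v) * (y ⊗ₜ 1)) =
      (MulOpposite.opLinearEquiv k).toLinearMap.rTensor Z (L.adSwap hL (v ⊗ₜ y)) := fun v => by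
    induction v using TensorProduct.induction_on with
    | zero => simp only [TensorProduct.zero_tmul, map_zero, zero_mul]
    | add a b ha hb => simp only [TensorProduct.add_tmul, map_add, add_mul, ha, hb]
    | tmul a w => rw [LinearMap.rTensor_tmul, h₁]; rfl
  exact h₂ _

/-- The isomorphism `Z ⊗ Zᵒᵖ ⊗ Z ≃ A ⊗ Z ⊗ Z` induced by the Galois map. -/
noncomputable def galoisPairs : Z ⊗[k] Pairs k Z ≃ₗ[k] (A ⊗[k] Z) ⊗[k] Z :=
  (TensorProduct.assoc k Z Zᵐᵒᵖ Z).symm ≪≫ₗ (L.galoisEquiv hL).rTensor Z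

theorem galoisPairs_one_tmul (x : Zᵐᵒᵖ) (y : Z) :
    L.galoisPairs hL (1 ⊗ₜ (x ⊗ₜ y)) = (1 ⊗ₜ x.unop) ⊗ₜ y := by
  change L.galoisEquiv hL (1 ⊗ₜ x) ⊗ₜ[k] y = _
  rw [galoisEquiv_tmul, map_one, one_mul]

/-- Through κ the descent condition reads x₍₋₁₎ y₍₋₁₎ ⊗ x₍₀₎ ⊗ y₍₀₎ = 1 ⊗ x ⊗ y, that is,
coinvariance under A. -/
theorem galoisPairs_descent (x : Zᵐᵒᵖ) (y : Z) :
    L.galoisPairs hL ((L.quantumTorsor hL).descent (x ⊗ₜ y)) =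
      (LinearMap.mulLeft k (L.coact x.unop) ∘ₗ
        Algebra.TensorProduct.includeLeft.toLinearMap).rTensor Z (L.coact y) := by
  have h₁ : ∀ s w, L.galoisPairs hL ((x.unop ⊗ₜ 1) * TensorProduct.assoc k Z Zᵐᵒᵖ Z (s ⊗ₜ w)) =
      L.galoisEquiv hL ((x.unop ⊗ₜ 1) * s) ⊗ₜ w := fun s w => by
    induction s using TensorProduct.induction_on with
    | zero => simp only [TensorProduct.zero_tmul, map_zero, mul_zero]
    | add a b ha hb => simp only [TensorProduct.add_tmul, map_add, mul_add, ha, hb]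
    | tmul p q =>
      rw [TensorProduct.assoc_tmul, Algebra.TensorProduct.tmul_mul_tmul,
        Algebra.TensorProduct.tmul_mul_tmul, one_mul, one_mul]
      rfl
  have h₂ : ∀ v : A ⊗[k] Z, L.galoisPairs hL ((x.unop ⊗ₜ 1) * TensorProduct.assoc k Z Zᵐᵒᵖ Z
      ((L.translation hL).toLinearMap.rTensor Z v)) =
      (LinearMap.mulLeft k (L.coact x.unop) ∘ₗ
        Algebra.TensorProduct.includeLeft.toLinearMap).rTensor Z v := fun v => by
    induction v using TensorProduct.induction_on with
    | zero => simp only [map_zero, mul_zero]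
    | add a b ha hb => simp only [map_add, mul_add, ha, hb]
    | tmul a w =>
      rw [LinearMap.rTensor_tmul, h₁, galoisEquiv_tmul_mul, AlgHom.toLinearMap_apply,
        galoisEquiv_translation, MulOpposite.unop_one, ← Algebra.TensorProduct.one_def, mul_one]
      rfl
  rw [QuantumTorsor.descent_tmul]
  exact h₂ _

/-- The map `s ⊗ y ↦ s (S(y₍₋₁₎) ⊗ 1) ⊗ y₍₀₎`. -/
noncomputable def antipodeShift : (A ⊗[k] Z) ⊗[k] Z →ₗ[k] (A ⊗[k] Z) ⊗[k] Z :=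
  (LinearMap.mul' k (A ⊗[k] Z) ∘ₗ (Algebra.TensorProduct.includeLeft.toLinearMap ∘ₗ
    HopfAlgebra.antipode k).lTensor (A ⊗[k] Z)).rTensor Z ∘ₗ
    (TensorProduct.assoc k (A ⊗[k] Z) A Z).symm.toLinearMap ∘ₗ
    L.coact.toLinearMap.lTensor (A ⊗[k] Z)

/-- Right multiplication by y₍₋₁₎ is undone by S: coassociativity brings y₍₋₂₎ S(y₍₋₁₎) together. -/
theorem antipodeShift_mulLeft (s : A ⊗[k] Z) (y : Z) :
    L.antipodeShift ((LinearMap.mulLeft k s ∘ₗ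
        Algebra.TensorProduct.includeLeft.toLinearMap).rTensor Z (L.coact y)) = s ⊗ₜ y := by
  -- O is b ⊗ c ⊗ w ↦ s (b S(c) ⊗ 1) ⊗ w.
  let O : A ⊗[k] (A ⊗[k] Z) →ₗ[k] (A ⊗[k] Z) ⊗[k] Z :=
    (LinearMap.mulLeft k s ∘ₗ Algebra.TensorProduct.includeLeft.toLinearMap ∘ₗ
      LinearMap.mul' k A ∘ₗ (HopfAlgebra.antipode k).lTensor A).rTensor Z ∘ₗ
      (TensorProduct.assoc k A A Z).symm.toLinearMap
  have h₁ : ∀ v, L.antipodeShift ((LinearMap.mulLeft k s ∘ₗ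
      Algebra.TensorProduct.includeLeft.toLinearMap).rTensor Z v) =
      O (L.coact.toLinearMap.lTensor A v) := fun v => by
    induction v using TensorProduct.induction_on with
    | zero => simp only [map_zero]
    | add a b ha hb => simp only [map_add, ha, hb]
    | tmul a w =>
      simp only [antipodeShift, O, LinearMap.comp_apply, LinearMap.rTensor_tmul,
        LinearMap.lTensor_tmul, AlgHom.toLinearMap_apply, LinearEquiv.coe_coe]
      induction L.coact w using TensorProduct.induction_on with
      | zero => simp only [TensorProduct.tmul_zero, map_zero]
      | add a b ha hb => simp only [TensorProduct.tmul_add, map_add, ha, hb]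
      | tmul c w =>
        simp only [TensorProduct.assoc_symm_tmul, LinearMap.comp_apply, LinearMap.rTensor_tmul,
          LinearMap.lTensor_tmul, AlgHom.toLinearMap_apply, LinearMap.mul'_apply,
          LinearMap.mulLeft_apply, Algebra.TensorProduct.includeLeft_apply, mul_assoc,
          Algebra.TensorProduct.tmul_mul_tmul, mul_one]
  have h₂ : ∀ v, O (TensorProduct.assoc k A A Z
      ((Coalgebra.comul (R := k) (A := A)).rTensor Z v)) =
      s ⊗ₜ TensorProduct.lid k Z ((Coalgebra.counit (R := k) (A := A)).rTensor Z v) := fun v => by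
    induction v using TensorProduct.induction_on with
    | zero => simp only [map_zero, TensorProduct.tmul_zero]
    | add a b ha hb => simp only [map_add, TensorProduct.tmul_add, ha, hb]
    | tmul a w =>
      have h₃ : ∀ d, O (TensorProduct.assoc k A A Z (d ⊗ₜ w)) =
          (s * (LinearMap.mul' k A ((HopfAlgebra.antipode k).lTensor A d) ⊗ₜ 1)) ⊗ₜ w :=
        fun d => by
          simp only [O, LinearMap.comp_apply, LinearEquiv.coe_coe, LinearEquiv.symm_apply_apply,
            LinearMap.rTensor_tmul]
          rfl
      rw [LinearMap.rTensor_tmul, h₃, HopfAlgebra.mul_antipode_lTensor_comul_apply,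
        LinearMap.rTensor_tmul, TensorProduct.lid_tmul, Algebra.algebraMap_eq_smul_one,
        ← TensorProduct.smul_tmul', mul_smul_comm, ← Algebra.TensorProduct.one_def, mul_one,
        TensorProduct.smul_tmul]
  rw [h₁, ← coassoc_apply, h₂, counit_coact_apply]

/-- The map `y ↦ S(y₍₋₁₎) ▷ y₍₀₎`. -/
noncomputable def adTwist : Z →ₗ[k] Z :=
  TensorProduct.lift (L.adAction hL ∘ₗ HopfAlgebra.antipode k) ∘ₗ L.coact.toLinearMap

/-- A single linear map G sends `descent t` to `flip t` and 1 ⊗ t to `twist t`, for every t; the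
descent condition equates its two arguments. -/
theorem flip_eq_twist (t : Pairs k Z) (ht : (L.quantumTorsor hL).descent t = 1 ⊗ₜ t) :
    (L.quantumTorsor hL).flip t = QuantumTorsor.twist (L.adTwist hL) t := by
  let G : Z ⊗[k] Pairs k Z →ₗ[k] Pairs k Z :=
    (MulOpposite.opLinearEquiv k).toLinearMap.rTensor Z ∘ₗ L.adSwap hL ∘ₗ L.antipodeShift ∘ₗ
      (L.galoisPairs hL).toLinearMap
  have h₁ : G ∘ₗ (L.quantumTorsor hL).descent = (L.quantumTorsor hL).flip :=
    TensorProduct.ext' fun x y => by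
      simp only [G, LinearMap.comp_apply, LinearEquiv.coe_coe]
      rw [galoisPairs_descent, antipodeShift_mulLeft, flip_tmul]
  have h₂ : G ∘ₗ TensorProduct.mk k Z (Pairs k Z) 1 = QuantumTorsor.twist (L.adTwist hL) :=
    TensorProduct.ext' fun x y => by
      simp only [G, LinearMap.comp_apply, LinearEquiv.coe_coe, TensorProduct.mk_apply]
      rw [galoisPairs_one_tmul, QuantumTorsor.twist_tmul]
      simp only [antipodeShift, adTwist, LinearMap.comp_apply, LinearMap.lTensor_tmul,
        AlgHom.toLinearMap_apply, LinearEquiv.coe_coe]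
      induction L.coact y using TensorProduct.induction_on with
      | zero => simp only [TensorProduct.tmul_zero, map_zero, MulOpposite.op_zero,
          TensorProduct.zero_tmul]
      | add a b ha hb => simp only [TensorProduct.tmul_add, map_add, MulOpposite.op_add,
          TensorProduct.add_tmul, ha, hb]
      | tmul c w =>
        simp only [TensorProduct.assoc_symm_tmul, LinearMap.rTensor_tmul, LinearMap.comp_apply,
          LinearMap.lTensor_tmul, LinearMap.mul'_apply, AlgHom.toLinearMap_apply,
          Algebra.TensorProduct.includeLeft_apply, Algebra.TensorProduct.tmul_mul_tmul, one_mul,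
          mul_one, adSwap_tmul, TensorProduct.lift.tmul]
        rfl
  rw [← h₁, ← h₂, LinearMap.comp_apply, ht]
  rfl

/-- The pairing `b ⊗ s ↦ (d ⊗ w ↦ b d ⊗ s⁽¹⁾ w s⁽²⁾)`. -/
noncomputable def mulAd : A ⊗[k] (Z ⊗[k] Zᵐᵒᵖ) →ₗ[k] A ⊗[k] Z →ₗ[k] A ⊗[k] Z :=
  TensorProduct.homTensorHomMap (RingHom.id k) A Z A Z ∘ₗ
    TensorProduct.map (LinearMap.mul k A) (AlgHom.mulLeftRight k Z).toLinearMap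

theorem mulAd_tmul (b : A) (s : Z ⊗[k] Zᵐᵒᵖ) (d : A) (w : Z) :
    mulAd (b ⊗ₜ s) (d ⊗ₜ w) = (b * d) ⊗ₜ AlgHom.mulLeftRight k Z s w := rfl

/-- Both sides are a₍₁₎ y₍₋₁₎ ⊗ (a₍₂₎ ▷ y₍₀₎): α is multiplicative, and `coact_translation` rewrites
α on the first leg of τ(a). -/
theorem galoisEquiv_translation_mul (a : A) (y : Z) :
    L.galoisEquiv hL (L.translation hL a * (y ⊗ₜ 1)) =
      mulAd ((L.translation hL).toLinearMap.lTensor A (Coalgebra.comul (R := k) a))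
        (L.coact y) := by
  have h : ∀ s, L.galoisEquiv hL (s * (y ⊗ₜ 1)) =
      mulAd (TensorProduct.assoc k A Z Zᵐᵒᵖ (L.coact.toLinearMap.rTensor Zᵐᵒᵖ s))
        (L.coact y) := fun s => by
    induction s using TensorProduct.induction_on with
    | zero => simp only [map_zero, zero_mul, LinearMap.zero_apply]
    | add a b ha hb => simp only [map_add, add_mul, LinearMap.add_apply, ha, hb]
    | tmul u v =>
      rw [Algebra.TensorProduct.tmul_mul_tmul, mul_one, galoisEquiv_tmul, map_mul,
        LinearMap.rTensor_tmul, AlgHom.toLinearMap_apply]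
      induction L.coact u using TensorProduct.induction_on with
      | zero => simp only [TensorProduct.zero_tmul, map_zero, zero_mul, LinearMap.zero_apply]
      | add a b ha hb => simp only [TensorProduct.add_tmul, map_add, add_mul,
          LinearMap.add_apply, ha, hb]
      | tmul b u =>
        induction L.coact y using TensorProduct.induction_on with
        | zero => simp only [map_zero, mul_zero, zero_mul]
        | add a b ha hb => simp only [map_add, mul_add, add_mul, ha, hb]
        | tmul d w =>
          rw [Algebra.TensorProduct.tmul_mul_tmul, Algebra.TensorProduct.tmul_mul_tmul, mul_one,
            TensorProduct.assoc_tmul, mulAd_tmul, AlgHom.mulLeftRight_apply]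
  rw [h, coact_translation]

/-- The map `(a ⊗ x) ⊗ y ↦ (a ⊗ (x₍₋₁₎ ▷ y)) ⊗ x₍₀₎`. -/
noncomputable def adShift : (A ⊗[k] Z) ⊗[k] Z →ₗ[k] (A ⊗[k] Z) ⊗[k] Z :=
  (TensorProduct.assoc k A Z Z).symm.toLinearMap ∘ₗ
    (L.adSwap hL ∘ₗ L.coact.toLinearMap.rTensor Z).lTensor A ∘ₗ
    (TensorProduct.assoc k A Z Z).toLinearMap

/-- Both sides are x₍₋₂₎ y₍₋₁₎ ⊗ (x₍₋₁₎ ▷ y₍₀₎) ⊗ x₍₀₎, by coassociativity of α. -/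
theorem galoisPairs_shift (x : Zᵐᵒᵖ) (y : Z) :
    L.galoisPairs hL ((L.quantumTorsor hL).shift (x ⊗ₜ y)) =
      L.adShift hL (L.galoisPairs hL ((L.quantumTorsor hL).descent (x ⊗ₜ y))) := by
  -- J is a ⊗ b ↦ a y₍₋₁₎ ⊗ (b ▷ y₍₀₎).
  let J : A ⊗[k] A →ₗ[k] A ⊗[k] Z :=
    mulAd.flip (L.coact y) ∘ₗ (L.translation hL).toLinearMap.lTensor A
  have h₁ : ∀ s w, L.galoisPairs hL (TensorProduct.assoc k Z Zᵐᵒᵖ Z (s ⊗ₜ w) * (y ⊗ₜ 1)) =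
      L.galoisEquiv hL (s * (y ⊗ₜ 1)) ⊗ₜ w := fun s w => by
    induction s using TensorProduct.induction_on with
    | zero => simp only [TensorProduct.zero_tmul, map_zero, zero_mul]
    | add a b ha hb => simp only [TensorProduct.add_tmul, map_add, add_mul, ha, hb]
    | tmul p q =>
      rw [TensorProduct.assoc_tmul, Algebra.TensorProduct.tmul_mul_tmul,
        Algebra.TensorProduct.tmul_mul_tmul, mul_one, mul_one]
      rfl
  have h₂ : ∀ v : A ⊗[k] Z, L.galoisPairs hL (TensorProduct.assoc k Z Zᵐᵒᵖ Z
      ((L.translation hL).toLinearMap.rTensor Z v) * (y ⊗ₜ 1)) =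
      J.rTensor Z ((TensorProduct.assoc k A A Z).symm (TensorProduct.assoc k A A Z
        ((Coalgebra.comul (R := k) (A := A)).rTensor Z v))) := fun v => by
    rw [LinearEquiv.symm_apply_apply]
    induction v using TensorProduct.induction_on with
    | zero => simp only [map_zero, zero_mul]
    | add a b ha hb => simp only [map_add, add_mul, ha, hb]
    | tmul a w =>
      rw [LinearMap.rTensor_tmul, h₁, AlgHom.toLinearMap_apply, galoisEquiv_translation_mul]
      rfl
  have h₃ : ∀ v : A ⊗[k] Z, L.adShift hL ((LinearMap.mulLeft k v ∘ₗ
      Algebra.TensorProduct.includeLeft.toLinearMap).rTensor Z (L.coact y)) =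
      J.rTensor Z ((TensorProduct.assoc k A A Z).symm (L.coact.toLinearMap.lTensor A v)) :=
    fun v => by
      simp only [J, LinearMap.rTensor_comp, LinearMap.comp_apply]
      induction L.coact y using TensorProduct.induction_on with
      | zero => simp only [map_zero, LinearMap.rTensor_zero, LinearMap.zero_apply]
      | add a b ha hb => simp only [map_add, LinearMap.rTensor_add, LinearMap.add_apply, ha, hb]
      | tmul d w =>
        induction v using TensorProduct.induction_on with
        | zero => simp only [map_zero, LinearMap.rTensor_tmul,
            LinearMap.mulLeft_apply, zero_mul, TensorProduct.zero_tmul]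
        | add a b ha hb =>
          simp only [map_add, LinearMap.rTensor_tmul,
            LinearMap.mulLeft_apply, add_mul, TensorProduct.add_tmul] at ha hb ⊢
          rw [ha, hb]
        | tmul a x =>
          simp only [LinearMap.rTensor_tmul, LinearMap.lTensor_tmul, LinearMap.comp_apply,
            LinearMap.mulLeft_apply, AlgHom.toLinearMap_apply, adShift, LinearEquiv.coe_coe,
            Algebra.TensorProduct.includeLeft_apply, Algebra.TensorProduct.tmul_mul_tmul, mul_one,
            TensorProduct.assoc_tmul]
          induction L.coact x using TensorProduct.induction_on with
          | zero => simp only [map_zero, TensorProduct.zero_tmul, TensorProduct.tmul_zero]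
          | add a b ha hb => simp only [map_add, TensorProduct.add_tmul, TensorProduct.tmul_add,
              ha, hb]
          | tmul c x => rfl
  rw [galoisPairs_descent, h₃, QuantumTorsor.shift_tmul]
  refine (h₂ (L.coact x.unop)).trans ?_
  rw [coassoc_apply]

/-- Conjugated by `galoisPairs`, `adShift` sends `descent t` to `shift t` and 1 ⊗ t to 1 ⊗ `flip t`;
under the descent condition these inputs coincide. -/
theorem shift_eq_one_tmul_flip (t : Pairs k Z)
    (ht : (L.quantumTorsor hL).descent t = 1 ⊗ₜ t) :
    (L.quantumTorsor hL).shift t = 1 ⊗ₜ (L.quantumTorsor hL).flip t := by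
  apply (L.galoisPairs hL).injective
  have h₁ : (L.galoisPairs hL).toLinearMap ∘ₗ (L.quantumTorsor hL).shift =
      L.adShift hL ∘ₗ (L.galoisPairs hL).toLinearMap ∘ₗ (L.quantumTorsor hL).descent :=
    TensorProduct.ext' (L.galoisPairs_shift hL)
  have h₂ : (L.galoisPairs hL).toLinearMap ∘ₗ TensorProduct.mk k Z (Pairs k Z) 1 ∘ₗ
      (L.quantumTorsor hL).flip =
      L.adShift hL ∘ₗ (L.galoisPairs hL).toLinearMap ∘ₗ TensorProduct.mk k Z (Pairs k Z) 1 :=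
    TensorProduct.ext' fun x y => by
      simp only [LinearMap.comp_apply, LinearEquiv.coe_coe, TensorProduct.mk_apply]
      rw [galoisPairs_one_tmul, flip_tmul]
      simp only [adShift, LinearMap.comp_apply, LinearEquiv.coe_coe, TensorProduct.assoc_tmul,
        LinearMap.lTensor_tmul, LinearMap.rTensor_tmul, AlgHom.toLinearMap_apply]
      induction L.adSwap hL (L.coact x.unop ⊗ₜ y) using TensorProduct.induction_on with
      | zero => simp only [map_zero, TensorProduct.tmul_zero]
      | add a b ha hb => simp only [map_add, TensorProduct.tmul_add, ha, hb]
      | tmul p q =>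
        rw [LinearMap.rTensor_tmul, galoisPairs_one_tmul]
        rfl
  have e₁ := LinearMap.congr_fun h₁ t
  have e₂ := LinearMap.congr_fun h₂ t
  rw [LinearMap.comp_apply, LinearMap.comp_apply, LinearMap.comp_apply, ht] at e₁
  exact e₁.trans e₂.symm

end LeftComoduleAlgebra

/-! ### Assembling the Hopf-Galois system. -/

/-- Transport a Hopf-Galois system along an isomorphism `T ≃ T'`. -/
noncomputable def HopfGaloisSystem.congrT {k A B Z T T' : Type*} [Field k] [Ring A]
    [Bialgebra k A] [Ring B] [Bialgebra k B] [Ring Z] [Algebra k Z] [Ring T] [Algebra k T]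
    [Ring T'] [Algebra k T'] (H : HopfGaloisSystem k A B Z T) (e : T ≃ₐ[k] T') :
    HopfGaloisSystem k A B Z T' where
  nontrivial_A := H.nontrivial_A
  nontrivial_B := H.nontrivial_B
  nontrivial_Z := H.nontrivial_Z
  nontrivial_T := haveI := H.nontrivial_T; e.symm.toEquiv.nontrivial
  left := H.left
  right := H.right
  bicomodule := H.bicomodule
  γ := (Algebra.TensorProduct.map (AlgHom.id k Z) e.toAlgHom).comp H.γ
  δ := (Algebra.TensorProduct.map e.toAlgHom (AlgHom.id k Z)).comp H.δ
  γ_left := by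
    have h := congrArg (fun f => (e.toLinearMap.rTensor Z).lTensor Z ∘ₗ f) H.γ_left
    have h₁ : (TensorProduct.assoc k Z T' Z).toLinearMap ∘ₗ
        (e.toLinearMap.lTensor Z).rTensor Z =
        (e.toLinearMap.rTensor Z).lTensor Z ∘ₗ (TensorProduct.assoc k Z T Z).toLinearMap :=
      TensorProduct.ext_threefold fun _ _ _ => rfl
    change (TensorProduct.assoc k Z T' Z).toLinearMap ∘ₗ
      (e.toLinearMap.lTensor Z ∘ₗ H.γ.toLinearMap).rTensor Z ∘ₗ H.left.coact.toLinearMap =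
      (e.toLinearMap.rTensor Z ∘ₗ H.δ.toLinearMap).lTensor Z ∘ₗ H.right.coact.toLinearMap
    rw [LinearMap.rTensor_comp, LinearMap.lTensor_comp, LinearMap.comp_assoc,
      LinearMap.comp_assoc, ← h, ← LinearMap.comp_assoc, h₁, LinearMap.comp_assoc]
  γ_comul := by
    have h := congrArg (fun f => (e.toLinearMap.lTensor Z).lTensor A ∘ₗ f) H.γ_comul
    have h₁ : (TensorProduct.assoc k A Z T').toLinearMap ∘ₗ
        H.left.coact.toLinearMap.rTensor T' ∘ₗ e.toLinearMap.lTensor Z =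
        (e.toLinearMap.lTensor Z).lTensor A ∘ₗ (TensorProduct.assoc k A Z T).toLinearMap ∘ₗ
          H.left.coact.toLinearMap.rTensor T := by
      rw [LinearMap.rTensor_comp_lTensor, ← LinearMap.lTensor_comp_rTensor,
        ← LinearMap.comp_assoc, ← LinearMap.comp_assoc]
      congr 1
      exact TensorProduct.ext_threefold fun _ _ _ => rfl
    change (e.toLinearMap.lTensor Z ∘ₗ H.γ.toLinearMap).lTensor A ∘ₗ Coalgebra.comul =
      (TensorProduct.assoc k A Z T').toLinearMap ∘ₗ
        H.left.coact.toLinearMap.rTensor T' ∘ₗ e.toLinearMap.lTensor Z ∘ₗ H.γ.toLinearMap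
    rw [LinearMap.lTensor_comp, LinearMap.comp_assoc, h]
    simpa only [LinearMap.comp_assoc] using
      congrArg (fun f => f ∘ₗ H.γ.toLinearMap) h₁.symm
  δ_comul := by
    have h := congrArg (fun f => e.toLinearMap.rTensor (Z ⊗[k] B) ∘ₗ f) H.δ_comul
    have h₁ : (TensorProduct.assoc k T' Z B).toLinearMap ∘ₗ
        (e.toLinearMap.rTensor Z).rTensor B =
        e.toLinearMap.rTensor (Z ⊗[k] B) ∘ₗ (TensorProduct.assoc k T Z B).toLinearMap :=
      TensorProduct.ext_threefold fun _ _ _ => rfl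
    change (TensorProduct.assoc k T' Z B).toLinearMap ∘ₗ
      (e.toLinearMap.rTensor Z ∘ₗ H.δ.toLinearMap).rTensor B ∘ₗ Coalgebra.comul =
      H.right.coact.toLinearMap.lTensor T' ∘ₗ e.toLinearMap.rTensor Z ∘ₗ H.δ.toLinearMap
    rw [LinearMap.rTensor_comp, LinearMap.comp_assoc, ← LinearMap.comp_assoc, h₁,
      LinearMap.comp_assoc, h, ← LinearMap.comp_assoc, LinearMap.rTensor_comp_lTensor,
      ← LinearMap.lTensor_comp_rTensor, LinearMap.comp_assoc]
  S := H.S ∘ₗ e.symm.toLinearMap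
  mul_S_γ := by
    rw [← H.mul_S_γ]
    congr 1
    change (H.S ∘ₗ e.symm.toLinearMap).lTensor Z ∘ₗ e.toLinearMap.lTensor Z ∘ₗ H.γ.toLinearMap = _
    rw [← LinearMap.comp_assoc, ← LinearMap.lTensor_comp]
    congr 2
    exact LinearMap.ext fun t => congrArg H.S (e.symm_apply_apply t)
  mul_S_δ := by
    rw [← H.mul_S_δ]
    congr 1
    change (H.S ∘ₗ e.symm.toLinearMap).rTensor Z ∘ₗ e.toLinearMap.rTensor Z ∘ₗ H.δ.toLinearMap = _
    rw [← LinearMap.comp_assoc, ← LinearMap.rTensor_comp]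
    congr 2
    exact LinearMap.ext fun t => congrArg H.S (e.symm_apply_apply t)

/-- The map m is left A-colinear, by coassociativity of α and `hτ`. For m = μ this gives the
bicomodule condition once B is embedded in Zᵒᵖ ⊗ Z. -/
theorem coact_rTensor_of_coact {k A V Z : Type*} [Field k] [AddCommGroup A] [Module k A]
    [AddCommGroup V] [Module k V] [AddCommGroup Z] [Module k Z] (α : Z →ₗ[k] A ⊗[k] Z)
    (D : A →ₗ[k] A ⊗[k] A) (τ : A →ₗ[k] Z ⊗[k] V)
    (hα : ∀ z, TensorProduct.assoc k A A Z (D.rTensor Z (α z)) = α.lTensor A (α z))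
    (hτ : ∀ a, TensorProduct.assoc k A Z V (α.rTensor V (τ a)) = τ.lTensor A (D a))
    (m : Z →ₗ[k] Z ⊗[k] (V ⊗[k] Z))
    (hm : ∀ z, m z = TensorProduct.assoc k Z V Z (τ.rTensor Z (α z))) (z : Z) :
    TensorProduct.assoc k A Z (V ⊗[k] Z) (α.rTensor (V ⊗[k] Z) (m z)) =
      m.lTensor A (α z) := by
  have h₁ : ∀ s w, TensorProduct.assoc k A Z (V ⊗[k] Z) (α.rTensor (V ⊗[k] Z)
      (TensorProduct.assoc k Z V Z (s ⊗ₜ w))) =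
      (TensorProduct.assoc k Z V Z).toLinearMap.lTensor A
        (TensorProduct.assoc k A (Z ⊗[k] V) Z
          (TensorProduct.assoc k A Z V (α.rTensor V s) ⊗ₜ w)) := fun s w => by
    induction s using TensorProduct.induction_on with
    | zero => simp
    | add a b ha hb => simp only [map_add, TensorProduct.add_tmul, ha, hb]
    | tmul p q =>
      rw [TensorProduct.assoc_tmul, LinearMap.rTensor_tmul, LinearMap.rTensor_tmul]
      induction α p using TensorProduct.induction_on with
      | zero => simp
      | add a b ha hb => simp only [map_add, TensorProduct.add_tmul, ha, hb]
      | tmul a z => simp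
  have h₂ : ∀ v, TensorProduct.assoc k A Z (V ⊗[k] Z) (α.rTensor (V ⊗[k] Z)
      (TensorProduct.assoc k Z V Z (τ.rTensor Z v))) =
      (TensorProduct.assoc k Z V Z).toLinearMap.lTensor A
        ((τ.rTensor Z).lTensor A (TensorProduct.assoc k A A Z (D.rTensor Z v))) := fun v => by
    induction v using TensorProduct.induction_on with
    | zero => simp
    | add a b ha hb => simp only [map_add, ha, hb]
    | tmul a w =>
      rw [LinearMap.rTensor_tmul, LinearMap.rTensor_tmul, h₁, hτ]
      congr 1
      induction D a using TensorProduct.induction_on with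
      | zero => simp
      | add a b ha hb => simp only [map_add, TensorProduct.add_tmul, ha, hb]
      | tmul a b => simp
  rw [hm, h₂, hα, ← LinearMap.comp_apply, ← LinearMap.comp_apply, ← LinearMap.lTensor_comp,
    ← LinearMap.lTensor_comp]
  congr 2
  exact LinearMap.ext fun z => (hm z).symm

namespace LeftComoduleAlgebra

variable {k A Z : Type*} [Field k] [Ring A] [HopfAlgebra k A] [Ring Z] [Algebra k Z]
  (L : LeftComoduleAlgebra k A Z) (hL : Function.Bijective L.galoisMap)

theorem bicomodule_apply (z : Z) :
    TensorProduct.assoc k A Z (L.quantumTorsor hL).structureAlgebra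
      (L.coact.toLinearMap.rTensor (L.quantumTorsor hL).structureAlgebra
        ((L.quantumTorsor hL).coact z)) =
    (L.quantumTorsor hL).coact.toLinearMap.lTensor A (L.coact z) := by
  set Q := L.quantumTorsor hL with hQ
  have hinj : Function.Injective ((Q.incl.lTensor Z).lTensor A) :=
    Module.Flat.lTensor_preserves_injective_linearMap _
      (Module.Flat.lTensor_preserves_injective_linearMap _ Q.incl_injective)
  apply hinj
  have h₁ : ∀ s, (Q.incl.lTensor Z).lTensor A (TensorProduct.assoc k A Z Q.structureAlgebra
      (L.coact.toLinearMap.rTensor Q.structureAlgebra s)) =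
      TensorProduct.assoc k A Z (Pairs k Z)
        (L.coact.toLinearMap.rTensor (Pairs k Z) (Q.incl.lTensor Z s)) := fun s => by
    induction s using TensorProduct.induction_on with
    | zero => simp only [map_zero]
    | add a b ha hb => simp only [map_add, ha, hb]
    | tmul z b =>
      rw [LinearMap.rTensor_tmul, LinearMap.lTensor_tmul, LinearMap.rTensor_tmul]
      induction L.coact.toLinearMap z using TensorProduct.induction_on with
      | zero => simp only [map_zero, TensorProduct.zero_tmul]
      | add a b ha hb => simp only [map_add, TensorProduct.add_tmul, ha, hb]
      | tmul a z => rfl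
  have h₂ : (Q.incl.lTensor Z).lTensor A (Q.coact.toLinearMap.lTensor A (L.coact z)) =
      Q.μ.toLinearMap.lTensor A (L.coact z) := by
    rw [← LinearMap.comp_apply, ← LinearMap.lTensor_comp]
    congr 2
    exact LinearMap.ext Q.lTensor_incl_coact
  rw [h₁, Q.lTensor_incl_coact, h₂]
  exact coact_rTensor_of_coact L.coact.toLinearMap Coalgebra.comul
    (L.translation hL).toLinearMap L.coassoc_apply (L.coact_translation hL)
    (L.torsorMap hL).toLinearMap (L.torsorMap_apply hL) z

/-- The Hopf-Galois system attached to a Galois extension of the base field. -/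
noncomputable def hopfGaloisSystem [Nontrivial Z] (φ : Z →ₗ[k] k) (hφ : φ 1 = 1) :
    letI := (L.quantumTorsor hL).bialgebra φ hφ
    HopfGaloisSystem k A (L.quantumTorsor hL).structureAlgebra Z Zᵐᵒᵖ :=
  letI := (L.quantumTorsor hL).bialgebra φ hφ
  { nontrivial_A := (Bialgebra.counitAlgHom k A).toRingHom.domain_nontrivial
    nontrivial_B := ((L.quantumTorsor hL).counit φ hφ).toRingHom.domain_nontrivial
    nontrivial_Z := inferInstance
    nontrivial_T := inferInstance
    left := L
    right := (L.quantumTorsor hL).rightComoduleAlgebra φ hφ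
    bicomodule := LinearMap.ext (L.bicomodule_apply hL)
    γ := L.translation hL
    δ := (L.quantumTorsor hL).structureAlgebra.val
    -- Both composites are μ: on one side by its definition from τ, on the other by the
    -- factorisation defining the coaction.
    γ_left := LinearMap.ext fun z => ((L.quantumTorsor hL).lTensor_incl_coact z).symm
    γ_comul := LinearMap.ext fun a => (L.coact_translation hL a).symm
    δ_comul := LinearMap.ext fun b =>
      (LinearEquiv.symm_apply_eq _).1 ((L.quantumTorsor hL).assoc_symm_lTensor_coact b) |>.symm
    S := (MulOpposite.opLinearEquiv k).symm.toLinearMap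
    mul_S_γ := LinearMap.ext (L.mul_translation hL)
    mul_S_δ := LinearMap.ext fun b => ((L.quantumTorsor hL).algebraMap_counit hφ b).symm }

end LeftComoduleAlgebra

theorem corollary1p8 (k : Type u) [Field k]
    (A : Type v) [Ring A] [HopfAlgebra k A] (Z : Type w) [Ring Z] [Algebra k Z]
    (L : LeftComoduleAlgebra k A Z) (hL : L.IsGalois) :
    ∃ (B : Type w) (_ : Ring B) (_ : HopfAlgebra k B)
      (T : Type (max v w)) (_ : Ring T) (_ : Algebra k T)
      (H : HopfGaloisSystem k A B Z T), H.left = L := by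
  obtain ⟨hZ, hbij⟩ := hL
  -- As Z ≠ 0, the unit k → Z is injective and has a linear retraction φ. It only serves to read off
  -- scalars in the counit.
  obtain ⟨φ, hφ⟩ := LinearMap.exists_leftInverse_of_injective (Algebra.linearMap k Z)
    (LinearMap.ker_eq_bot.2 (algebraMap k Z).injective)
  have hφ : φ 1 = 1 := by simpa using LinearMap.congr_fun hφ 1
  exact ⟨(L.quantumTorsor hbij).structureAlgebra, inferInstance,
    (L.quantumTorsor hbij).hopfAlgebra (L.shift_eq_one_tmul_flip hbij) (L.adTwist hbij)
      (L.flip_eq_twist hbij) φ hφ,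
    -- T is Zᵒᵖ raised to the required universe; changing T leaves the left coaction untouched,
    -- hence the final `rfl`.
    ULift.{v} Zᵐᵒᵖ, inferInstance, inferInstance,
    letI := (L.quantumTorsor hbij).bialgebra φ hφ
    (L.hopfGaloisSystem hbij φ hφ).congrT ULift.algEquiv.symm, rfl⟩
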